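/- **Theorem (spectral representation of the hidden variables).** Let $\Omega$ be a (possibly unbounded) self-adjoint operator in a complex Hilbert space $\mathcal H$, and let $\mathcal H=H_1\oplus H_2$ be an orthogonal splitting into closed subspaces with respect to which $$\Omega=\begin{bmatrix}\Omega_1&\Gamma\\ \Gamma^\dagger&\Omega_2\end{bmatrix},$$ with a bounded operator $\Gamma:H_2\to H_1$; that is, the domain of $\Omega$ is invariant under the orthogonal projection $P_1$ onto $H_1$, $\Omega_2$ is the compression of $\Omega$ to $H_2$ (with domain $\mathrm{Dom}\,\Omega\cap H_2$), and $\Gamma x=P_1\Omega x$ for $x\in\mathrm{Dom}\,\Omega\cap H_2$. For a self-adjoint operator $T$ and a set $S$ of vectors let $\mathcal O_T(S)$ be the closed linear span of $\{f(T)w: f\in C_c(\mathbb R),\ w\in S\}$. Let $\mathcal H_{\min}=\mathcal O_\Omega(H_1)$ be the state space of the minimal conservative extension within $(\mathcal H,\Omega)$ of the open system obtained by projecting the dynamics onto $H_1$, and let $H_{2c}=\mathcal H_{\min}\ominus H_1\subseteq H_2$. An operator has pure point spectrum if its eigenvectors span a dense subspace. 1. If $\Omega_2$ has pure point spectrum,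 then $$H_{2c}=\mathcal O_{\Omega_2}(\mathrm{Ran}\,\Gamma^\dagger)=\bigoplus_\alpha \pi_{2\alpha}(\mathrm{Ran}\,\Gamma^\dagger),$$ where $\pi_{2\alpha}$ are the orthogonal projections in $H_2$ onto the eigenspaces of $\Omega_2$; the right-hand side is the closure of the linear span of the mutually orthogonal subspaces $\pi_{2\alpha}(\mathrm{Ran}\,\Gamma^\dagger)$. 2. In general, $\Omega_2$ has a spectral resolution of the identity, i.e. a projection-valued Borel measure $E_2$ on $\mathbb R$ with $f(\Omega_2)=\int f\,dE_2$ for all $f\in C_c(\mathbb R)$, and for it $H_{2c}$ is the closure of the linear span of the subspaces $E_2(\Delta)(\mathrm{Ran}\,\Gamma^\dagger)$, $\Delta$ an interval of $\mathbb R$. For every $\varepsilon>0$ the same holds if only intervals $\Delta$ contained in some interval of length $\varepsilon$ are used. 3. If $\Omega_2$ has pure point spectrum, then $H_{2c}=H_2$ if and only if $\Gamma\phi\neq0$ for every eigenmode (eigenvector) $\phi$ of $\Omega_2$. -/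

import Mathlib

open scoped InnerProductSpace

namespace OpenSystem

noncomputable section

variable {H : Type*} [NormedAddCommGroup H] [InnerProductSpace ℂ H]

/-- The bounded operator `R` is the inverse of `T - z`, where `T` is a (possibly unbounded)
operator: `R` maps `H` onto the domain of `T`, and `x = R y` if and only if `(T - z) x = y`. -/
def IsResolventAt (T : H →ₗ.[ℂ] H) (z : ℂ) (R : H →L[ℂ] H) : Prop :=
  ∀ x y : H, R y = x ↔ ∃ hx : x ∈ T.domain, T ⟨x, hx⟩ - z • x = y

open scoped Classical in
/-- The resolvent `(T - z)⁻¹` (zero if `T - z` has no bounded everywhere defined inverse,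
which does not happen for self-adjoint `T` and non-real `z`). -/
def resolventOp (T : H →ₗ.[ℂ] H) (z : ℂ) : H →L[ℂ] H :=
  if h : ∃ R : H →L[ℂ] H, IsResolventAt T z R then h.choose else 0

/-- The function `g` of the variable `z = (x - i)⁻¹` that corresponds to the function `f` of the
real variable `x`: `g ((x - i)⁻¹) = f x`, and `g 0 = 0` is the value of `f` at infinity. -/
def resolventSymbol (f : ℝ → ℂ) (z : ℂ) : ℂ :=
  if z = 0 then 0 else f (z⁻¹).re

/-- The operator `f(T)` of the continuous functional calculus of a self-adjoint operator `T`, for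
a continuous function `f` with compact support: it is `g(R)` for the bounded normal operator
`R = (T - i)⁻¹` and the function `g` with `g ((x - i)⁻¹) = f x` for real `x` and `g 0 = 0`. -/
def funCalc [CompleteSpace H] (T : H →ₗ.[ℂ] H) (f : ℝ → ℂ) : H →L[ℂ] H :=
  cfc (resolventSymbol f) (resolventOp T Complex.I)

/-- The closed orbit of the set `S` under the action of `T`: the closed linear span of the vectors
`f(T) w`, where `f` is continuous with compact support and `w ∈ S`. -/
def orbit [CompleteSpace H] (T : H →ₗ.[ℂ] H) (S : Set H) : Submodule ℂ H :=
  (Submodule.span ℂ {x : H | ∃ f : ℝ → ℂ, Continuous f ∧ HasCompactSupport f ∧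
    ∃ w ∈ S, x = funCalc T f w}).topologicalClosure

/-- The eigenspace of the operator `T` for the value `z` (zero if `z` is not an eigenvalue). -/
def eigenspace (T : H →ₗ.[ℂ] H) (z : ℂ) : Submodule ℂ H where
  carrier := {x | ∃ hx : x ∈ T.domain, T ⟨x, hx⟩ = z • x}
  zero_mem' := ⟨T.domain.zero_mem, by
    rw [smul_zero]; exact T.map_zero⟩
  add_mem' := by
    rintro x y ⟨hx, hTx⟩ ⟨hy, hTy⟩
    refine ⟨T.domain.add_mem hx hy, ?_⟩
    have h : T (⟨x, hx⟩ + ⟨y, hy⟩) = T ⟨x, hx⟩ + T ⟨y, hy⟩ := T.map_add _ _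
    rw [hTx, hTy, ← smul_add] at h
    exact h
  smul_mem' := by
    rintro c x ⟨hx, hTx⟩
    refine ⟨T.domain.smul_mem c hx, ?_⟩
    have h : T (c • ⟨x, hx⟩) = c • T ⟨x, hx⟩ := T.map_smul _ _
    rw [hTx, smul_comm] at h
    exact h

/-- The orthogonal projection onto the eigenspace of `T` for the value `z`. (The eigenspaces of a
self-adjoint operator are closed, so that the closure changes nothing for them.) -/
def eigenProj [CompleteSpace H] (T : H →ₗ.[ℂ] H) (z : ℂ) : H →L[ℂ] H :=
  (eigenspace T z).topologicalClosure.starProjection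

/-- An eigenmode of `T` is an eigenvector of `T`. -/
def IsEigenmode (T : H →ₗ.[ℂ] H) (φ : H) : Prop :=
  φ ≠ 0 ∧ ∃ z : ℂ, φ ∈ eigenspace T z

/-- `T` has pure point spectrum: the space is the closed linear span of the eigenspaces of `T`. -/
def HasPurePointSpectrum (T : H →ₗ.[ℂ] H) : Prop :=
  (⨆ z : ℂ, eigenspace T z).topologicalClosure = ⊤

/-- A projection-valued Borel measure on the real line, as a function on sets whose values matter
on Borel sets only: an orthogonal projection `E B` for each Borel set `B`, with `E ℝ = 1` and
countably additive in the strong operator topology. -/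
structure ProjectionValuedMeasure (H : Type*) [NormedAddCommGroup H] [InnerProductSpace ℂ H]
    [CompleteSpace H] where
  proj : Set ℝ → H →L[ℂ] H
  isStarProjection : ∀ B : Set ℝ, MeasurableSet B → IsStarProjection (proj B)
  proj_empty : proj ∅ = 0
  proj_univ : proj Set.univ = 1
  proj_inter : ∀ A B : Set ℝ, MeasurableSet A → MeasurableSet B →
    proj (A ∩ B) = proj A * proj B
  hasSum_proj : ∀ B : ℕ → Set ℝ, (∀ n, MeasurableSet (B n)) →
    Pairwise (fun m n => Disjoint (B m) (B n)) →
    ∀ v : H, HasSum (fun n => proj (B n) v) (proj (⋃ n, B n) v)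

/-- The finite positive measure `B ↦ ⟪v, E(B) v⟫` on the real line. -/
def ProjectionValuedMeasure.measure [CompleteSpace H] (E : ProjectionValuedMeasure H) (v : H) :
    MeasureTheory.Measure ℝ :=
  MeasureTheory.Measure.ofMeasurable (fun B _ => ENNReal.ofReal (⟪v, E.proj B v⟫_ℂ).re)
    (by simp [E.proj_empty])
    (by
      intro B hB hd
      have hs : HasSum (fun n => (⟪v, E.proj (B n) v⟫_ℂ).re) (⟪v, E.proj (⋃ n, B n) v⟫_ℂ).re :=
        Complex.hasSum_re (((innerSL ℂ v).hasSum (E.hasSum_proj B hB hd v)))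
      have hn : ∀ n, 0 ≤ (⟪v, E.proj (B n) v⟫_ℂ).re := fun n => by
        have h := (ContinuousLinearMap.IsPositive.of_isStarProjection
          (E.isStarProjection (B n) (hB n))).re_inner_nonneg_right v
        simpa using h
      rw [← hs.tsum_eq, ENNReal.ofReal_tsum_of_nonneg hn hs.summable])

/-- `E` is the spectral resolution of the identity for the self-adjoint operator `T`:
`f(T) = ∫ f dE` for each continuous function `f` with compact support. The operator on the right
is determined by its quadratic form `v ↦ ∫ f d⟪v, E v⟫`. -/
def IsSpectralResolution [CompleteSpace H] (T : H →ₗ.[ℂ] H) (E : ProjectionValuedMeasure H) :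
    Prop :=
  ∀ f : ℝ → ℂ, Continuous f → HasCompactSupport f →
    ∀ v : H, ⟪v, funCalc T f v⟫_ℂ = ∫ x, f x ∂(E.measure v)

/-- The compression of the operator `T` to the subspace `K`: its domain consists of the vectors of
`K` in the domain of `T`, and it maps `x` to the orthogonal projection of `T x` onto `K`. For a
block operator matrix on `K ⊕ Kᗮ` these are the diagonal entries. -/
def compression (T : H →ₗ.[ℂ] H) (K : Submodule ℂ H) [K.HasOrthogonalProjection] :
    K →ₗ.[ℂ] K where
  domain := T.domain.comap K.subtype
  toFun := (K.orthogonalProjectionOnto : H →ₗ[ℂ] K) ∘ₗ T.toFun ∘ₗ K.subtype.submoduleComap T.domain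

/-- With respect to the splitting `H = H₁ ⊕ H₁ᗮ`, the self-adjoint operator `T` is a block operator
matrix with the bounded off-diagonal entry `Γ : H₁ᗮ → H₁`: the domain of `T` splits, and `Γ x` is
the component of `T x` in `H₁` for `x ∈ H₁ᗮ` in the domain. (By symmetry of `T` the other
off-diagonal entry is then the adjoint of `Γ`.) -/
structure HasBoundedCoupling (T : H →ₗ.[ℂ] H) (H₁ : Submodule ℂ H) [H₁.HasOrthogonalProjection]
    (Γ : H₁ᗮ →L[ℂ] H₁) : Prop where
  proj_mem_domain : ∀ x ∈ T.domain, H₁.starProjection x ∈ T.domain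
  coupling_apply : ∀ (x : H₁ᗮ) (hx : (x : H) ∈ T.domain),
    Γ x = H₁.orthogonalProjectionOnto (T ⟨x, hx⟩)

/-- The state space of the minimal conservative extension, within `(H, T)`, of the open system
obtained by projecting the dynamics of `(H, T)` to `H₁`. -/
def minimalExtension [CompleteSpace H] (T : H →ₗ.[ℂ] H) (H₁ : Submodule ℂ H) : Submodule ℂ H :=
  orbit T (H₁ : Set H)

/-- The coupled component of the space `H₁ᗮ` of hidden variables: the orthogonal complement of `H₁`
in the state space of the minimal conservative extension, as a subspace of `H₁ᗮ`. -/
def coupledComponent [CompleteSpace H] (T : H →ₗ.[ℂ] H) (H₁ : Submodule ℂ H) :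
    Submodule ℂ H₁ᗮ :=
  (minimalExtension T H₁).comap H₁ᗮ.subtype

end

end OpenSystem

/-!
The closed orbit of a set `S` under a self-adjoint operator `T` is the smallest closed subspace that
contains `S` and reduces `T`. In a block operator matrix with bounded coupling `Γ`, a subspace
`H₁ ⊕ K₂` reduces `Ω` if and only if `K₂` reduces `Ω₂` and contains the range of `Γ†`, so the
coupled component is the orbit of `Ran Γ†` under `Ω₂`.

A subspace `K` reduces `T` if and only if the orthogonal projection onto `K` commutes with the
resolvent of `T`, equivalently with all `f(T)`, with all spectral projections, or, for a pure point
spectrum, with all projections onto eigenspaces. Hence the smallest reducing subspace containing `R`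
is spanned by the images of `R` under any of these families of projections. The projections of short
intervals already suffice, since short intervals are a π-system that generates the Borel sets and
countably many of them partition the line. If the spectrum is pure point and the orbit of `Ran Γ†`
is not dense, its orthogonal complement reduces `Ω₂` and thus contains an eigenmode, which is in the
kernel of `Γ`.

The spectral projections are strong limits of `f(T)` as `f` tends to an indicator function: the
Riesz–Markov theorem represents `f ↦ ⟪v, f(T) v⟫` by a measure `μ`, and `f ↦ f(T) v` is an isometry
for the norm of `L²(μ)`.
-/

namespace OpenSystem

open Filter MeasureTheory Topology
open scoped CompactlySupported ENNReal

section Resolvent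

variable {H : Type*} [NormedAddCommGroup H] [InnerProductSpace ℂ H]
  {T : H →ₗ.[ℂ] H} {z : ℂ}

theorem isResolventAt_iff_mem_graph {R : H →L[ℂ] H} :
    IsResolventAt T z R ↔ ∀ x y : H, R y = x ↔ (x, y + z • x) ∈ T.graph := by
  refine forall₂_congr fun x y => iff_congr Iff.rfl ?_
  simp only [LinearPMap.mem_graph_iff, Subtype.exists, sub_eq_iff_eq_add]
  constructor
  · exact fun ⟨hx, h⟩ => ⟨x, hx, rfl, h⟩
  · rintro ⟨x, hx, rfl, h⟩
    exact ⟨hx, h⟩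

theorem IsResolventAt.mem_eigenspace_iff {R : H →L[ℂ] H} (hR : IsResolventAt T z R) {w : ℂ}
    {x : H} : x ∈ eigenspace T w ↔ R ((w - z) • x) = x := by
  rw [hR]
  change (∃ hx : x ∈ T.domain, T ⟨x, hx⟩ = w • x) ↔ _
  simp only [sub_smul, sub_left_inj]

theorem IsResolventAt.isClosed_eigenspace {R : H →L[ℂ] H} (hR : IsResolventAt T z R) (w : ℂ) :
    IsClosed (eigenspace T w : Set H) := by
  have h : (eigenspace T w : Set H) = {x | R ((w - z) • x) = x} :=
    Set.ext fun x => hR.mem_eigenspace_iff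
  rw [h]
  exact isClosed_eq (by fun_prop) (by fun_prop)

theorem IsResolventAt.apply_of_mem_eigenspace {R : H →L[ℂ] H} (hR : IsResolventAt T z R) {w : ℂ}
    {x : H} (hx : x ∈ eigenspace T w) : R x = (w - z)⁻¹ • x := by
  rw [hR.mem_eigenspace_iff, map_smul] at hx
  by_cases h : w - z = 0
  · rw [h, zero_smul] at hx
    simp [← hx]
  · rwa [eq_inv_smul_iff₀ h]

/-- The operator `T - z`, as a bounded operator on the graph of `T`. -/
def graphSub (T : H →ₗ.[ℂ] H) (z : ℂ) : T.graph →L[ℂ] H :=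
  (ContinuousLinearMap.snd ℂ H H - z • ContinuousLinearMap.fst ℂ H H) ∘L T.graph.subtypeL

theorem graphSub_apply (p : T.graph) : graphSub T z p = p.1.2 - z • p.1.1 := rfl

variable [CompleteSpace H]

theorem isSelfAdjoint_iff_mem_graph (hd : Dense (T.domain : Set H)) :
    IsSelfAdjoint T ↔ ∀ y w : H, (y, w) ∈ T.graph ↔
      ∀ x v : H, (x, v) ∈ T.graph → ⟪v, y⟫_ℂ = ⟪x, w⟫_ℂ := by
  have hadj : ∀ y w : H, (y, w) ∈ T.adjoint.graph ↔
      ∀ x v : H, (x, v) ∈ T.graph → ⟪v, y⟫_ℂ = ⟪x, w⟫_ℂ := fun y w => by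
    simp only [LinearPMap.adjoint_graph_eq_graph_adjoint hd, Submodule.mem_adjoint_iff,
      sub_eq_zero]
  simp only [LinearPMap.isSelfAdjoint_def, ← hadj]
  refine ⟨fun h y w => by rw [h], fun h => LinearPMap.eq_of_eq_graph ?_⟩
  ext ⟨y, w⟩
  exact (h y w).symm

theorem mem_graph_iff_of_isSelfAdjoint (hT : IsSelfAdjoint T) {y w : H} :
    (y, w) ∈ T.graph ↔ ∀ x v : H, (x, v) ∈ T.graph → ⟪v, y⟫_ℂ = ⟪x, w⟫_ℂ :=
  (isSelfAdjoint_iff_mem_graph hT.dense_domain).1 hT y w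

theorem inner_eq_of_mem_graph (hT : IsSelfAdjoint T) {x v y w : H} (hx : (x, v) ∈ T.graph)
    (hy : (y, w) ∈ T.graph) : ⟪v, y⟫_ℂ = ⟪x, w⟫_ℂ :=
  (mem_graph_iff_of_isSelfAdjoint hT).1 hy x v hx

theorem abs_im_mul_norm_le (hT : IsSelfAdjoint T) (z : ℂ) {x y : H} (hx : (x, y) ∈ T.graph) :
    |z.im| * ‖x‖ ≤ ‖y - z • x‖ := by
  have hreal : (⟪x, y⟫_ℂ).im = 0 := by
    rw [← Complex.conj_eq_iff_im, inner_conj_symm, inner_eq_of_mem_graph hT hx hx]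
  have him : (⟪x, y - z • x⟫_ℂ).im = -(z.im * ‖x‖ ^ 2) := by
    rw [inner_sub_right, inner_smul_right, inner_self_eq_norm_sq_to_K, Complex.sub_im, hreal]
    simp [Complex.mul_im, ← Complex.ofReal_pow]
  have hmul : ‖x‖ * (|z.im| * ‖x‖) ≤ ‖x‖ * ‖y - z • x‖ := calc
    ‖x‖ * (|z.im| * ‖x‖) = |(⟪x, y - z • x⟫_ℂ).im| := by
      rw [him, abs_neg, abs_mul, abs_of_nonneg (sq_nonneg ‖x‖)]
      ring
    _ ≤ ‖⟪x, y - z • x⟫_ℂ‖ := Complex.abs_im_le_norm _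
    _ ≤ ‖x‖ * ‖y - z • x‖ := norm_inner_le_norm _ _
  rcases (norm_nonneg x).eq_or_lt with h | h
  · simp [← h]
  · exact le_of_mul_le_mul_left hmul h

theorem antilipschitz_graphSub (hT : IsSelfAdjoint T) (hz : z.im ≠ 0) :
    ∃ C, AntilipschitzWith C (graphSub T z) := by
  have hz' : 0 < |z.im| := abs_pos.2 hz
  refine ⟨(max |z.im|⁻¹ (1 + ‖z‖ * |z.im|⁻¹)).toNNReal, (graphSub T z).antilipschitz_of_bound ?_⟩
  rintro ⟨⟨x, y⟩, hp⟩
  rw [Real.coe_toNNReal _ (by positivity), graphSub_apply]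
  have hx : ‖x‖ ≤ |z.im|⁻¹ * ‖y - z • x‖ := by
    rw [le_inv_mul_iff₀ hz']
    exact abs_im_mul_norm_le hT z hp
  have hy : ‖y‖ ≤ (1 + ‖z‖ * |z.im|⁻¹) * ‖y - z • x‖ := calc
    ‖y‖ = ‖(y - z • x) + z • x‖ := by rw [sub_add_cancel]
    _ ≤ ‖y - z • x‖ + ‖z‖ * ‖x‖ := by rw [← norm_smul]; exact norm_add_le _ _
    _ ≤ ‖y - z • x‖ + ‖z‖ * (|z.im|⁻¹ * ‖y - z • x‖) := by gcongr
    _ = (1 + ‖z‖ * |z.im|⁻¹) * ‖y - z • x‖ := by ring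
  refine max_le (hx.trans ?_) (hy.trans ?_) <;> gcongr
  exacts [le_max_left _ _, le_max_right _ _]

theorem denseRange_graphSub (hT : IsSelfAdjoint T) (hz : z.im ≠ 0) :
    DenseRange (graphSub T z) := by
  change Dense ((graphSub T z).range : Set H)
  rw [Submodule.dense_iff_topologicalClosure_eq_top, Submodule.topologicalClosure_eq_top_iff,
    Submodule.eq_bot_iff]
  intro y hy
  have hg : (y, (starRingEnd ℂ z) • y) ∈ T.graph := by
    refine (mem_graph_iff_of_isSelfAdjoint hT).2 fun x v hx => ?_
    have h : ⟪v - z • x, y⟫_ℂ = 0 :=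
      Submodule.inner_right_of_mem_orthogonal
        (LinearMap.mem_range_self _ (⟨(x, v), hx⟩ : T.graph)) hy
    rwa [inner_sub_left, inner_smul_left, ← inner_smul_right, sub_eq_zero] at h
  have h := abs_im_mul_norm_le hT (starRingEnd ℂ z) hg
  rw [sub_self, norm_zero, Complex.conj_im, abs_neg] at h
  exact norm_le_zero_iff.1 (nonpos_of_mul_nonpos_right h (abs_pos.2 hz))

theorem exists_isResolventAt (hT : IsSelfAdjoint T) (hz : z.im ≠ 0) :
    ∃ R : H →L[ℂ] H, IsResolventAt T z R := by
  have hcl : IsClosed (T.graph : Set (H × H)) := hT.isClosed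
  have : CompleteSpace T.graph := hcl.completeSpace_coe
  have hbij : Function.Bijective (graphSub T z) :=
    (graphSub T z).bijective_iff_dense_range_and_antilipschitz.2
      ⟨Submodule.dense_iff_topologicalClosure_eq_top.1 (denseRange_graphSub hT hz),
        antilipschitz_graphSub hT hz⟩
  let e := ContinuousLinearEquiv.ofBijective (graphSub T z)
    (LinearMap.ker_eq_bot.2 hbij.1) (LinearMap.range_eq_top.2 hbij.2)
  have he : ∀ p : T.graph, e p = p.1.2 - z • p.1.1 := graphSub_apply
  refine ⟨ContinuousLinearMap.fst ℂ H H ∘L T.graph.subtypeL ∘L (e.symm : H →L[ℂ] T.graph),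
    isResolventAt_iff_mem_graph.2 fun x y => ⟨?_, fun h => ?_⟩⟩
  · rintro rfl
    have h := he (e.symm y)
    rw [e.apply_symm_apply, eq_comm, sub_eq_iff_eq_add] at h
    convert (e.symm y).2 using 1
    exact Prod.ext rfl h.symm
  · have h' : e.symm y = ⟨(x, y + z • x), h⟩ := by simp [e.symm_apply_eq, he]
    simp [h']

theorem isResolventAt_resolventOp (hT : IsSelfAdjoint T) (hz : z.im ≠ 0) :
    IsResolventAt T z (resolventOp T z) := by
  have h := exists_isResolventAt hT hz
  rw [resolventOp, dif_pos h]
  exact h.choose_spec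

theorem resolventOp_eq_iff (hT : IsSelfAdjoint T) (hz : z.im ≠ 0) {x y : H} :
    resolventOp T z y = x ↔ (x, y + z • x) ∈ T.graph :=
  isResolventAt_iff_mem_graph.1 (isResolventAt_resolventOp hT hz) x y

theorem resolventOp_mem_graph (hT : IsSelfAdjoint T) (hz : z.im ≠ 0) (y : H) :
    (resolventOp T z y, y + z • resolventOp T z y) ∈ T.graph :=
  (resolventOp_eq_iff hT hz).1 rfl

theorem isClosed_eigenspace (hT : IsSelfAdjoint T) (w : ℂ) :
    IsClosed (eigenspace T w : Set H) :=
  (isResolventAt_resolventOp hT (z := Complex.I) (by simp)).isClosed_eigenspace w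

theorem star_resolventOp (hT : IsSelfAdjoint T) (hz : z.im ≠ 0) :
    star (resolventOp T z) = resolventOp T (starRingEnd ℂ z) := by
  rw [ContinuousLinearMap.star_eq_adjoint, eq_comm, ContinuousLinearMap.eq_adjoint_iff]
  intro x y
  have hz' : (starRingEnd ℂ z).im ≠ 0 := by simpa using hz
  have h := inner_eq_of_mem_graph hT (resolventOp_mem_graph hT hz' x)
    (resolventOp_mem_graph hT hz y)
  simp only [inner_add_left, inner_add_right, inner_smul_left, inner_smul_right,
    Complex.conj_conj] at h
  exact (add_right_cancel h).symm

theorem resolventOp_sub (hT : IsSelfAdjoint T) {w : ℂ} (hz : z.im ≠ 0) (hw : w.im ≠ 0) :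
    resolventOp T z - resolventOp T w = (z - w) • (resolventOp T z * resolventOp T w) := by
  ext y
  have h : resolventOp T z (y - (z - w) • resolventOp T w y) = resolventOp T w y := by
    rw [resolventOp_eq_iff hT hz]
    convert resolventOp_mem_graph hT hw y using 2
    module
  rw [map_sub, map_smul, sub_eq_iff_eq_add] at h
  simp [h]

theorem star_resolventOp_I (hT : IsSelfAdjoint T) :
    star (resolventOp T Complex.I) = resolventOp T (-Complex.I) := by
  rw [star_resolventOp hT (by simp), Complex.conj_I]

theorem isStarNormal_resolventOp_I (hT : IsSelfAdjoint T) :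
    IsStarNormal (resolventOp T Complex.I) := by
  have h₁ := resolventOp_sub hT (z := Complex.I) (w := -Complex.I) (by simp) (by simp)
  have h₂ := resolventOp_sub hT (z := -Complex.I) (w := Complex.I) (by simp) (by simp)
  rw [← neg_sub (resolventOp T Complex.I), h₁, ← neg_smul, neg_sub] at h₂
  rw [isStarNormal_iff, star_resolventOp_I hT]
  exact (smul_right_injective _ (by norm_num [Complex.ext_iff]) h₂).symm

/-- The circle through `0` that consists of the points `z` with `Im z = |z|²`: the Möbius
transformation `x ↦ (x - i)⁻¹` maps the real line onto this circle without the point `0`. -/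
def resolventCircle : Set ℂ := {z | z.im = Complex.normSq z}

theorem spectrum_resolventOp_I_subset (hT : IsSelfAdjoint T) :
    spectrum ℂ (resolventOp T Complex.I) ⊆ resolventCircle := by
  intro z hz
  have hn := isStarNormal_resolventOp_I hT
  have hcfc : cfc (fun z : ℂ => z - star z) (resolventOp T Complex.I) =
      cfc (fun z : ℂ => (2 * Complex.I) • (z * star z)) (resolventOp T Complex.I) := by
    rw [cfc_sub (fun z : ℂ => z) (fun z : ℂ => star z), cfc_smul (2 * Complex.I)
      (fun z : ℂ => z * star z) (resolventOp T Complex.I),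
      cfc_mul (fun z : ℂ => z) (fun z : ℂ => star z), cfc_star (fun z : ℂ => z), cfc_id' ℂ _,
      star_resolventOp_I hT, resolventOp_sub hT (by simp) (by simp), sub_neg_eq_add, ← two_mul]
  have h : z - star z = (2 * Complex.I) * (z * star z) :=
    eqOn_of_cfc_eq_cfc hcfc (by fun_prop) (by fun_prop) hn hz
  have him := congrArg Complex.im h
  rw [Complex.star_def, Complex.mul_conj] at him
  simp only [Complex.sub_im, Complex.conj_im, sub_neg_eq_add, Complex.mul_im, Complex.mul_re,
    Complex.re_ofNat, Complex.I_re, mul_zero, Complex.im_ofNat, Complex.I_im, mul_one, sub_self,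
    Complex.ofReal_im, add_zero, Complex.ofReal_re, zero_add] at him
  change z.im = Complex.normSq z
  linarith

end Resolvent

section ResolventSymbol

theorem inv_eq_of_mem_resolventCircle {z : ℂ} (hz : z ∈ resolventCircle) (hz₀ : z ≠ 0) :
    z⁻¹ = ((z⁻¹).re : ℂ) - Complex.I := by
  have hne : Complex.normSq z ≠ 0 := (Complex.normSq_pos.2 hz₀).ne'
  have him : (z⁻¹).im = -1 := by
    rw [Complex.inv_im, show z.im = Complex.normSq z from hz, neg_div, div_self hne]
  exact Complex.ext (by simp) (by simp [him])

theorem resolventSymbol_eq_zero_of_norm_mul_lt {f : ℝ → ℂ} {r : ℝ}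
    (hf : tsupport f ⊆ Metric.closedBall 0 r) {z : ℂ} (hz : z ∈ resolventCircle)
    (hr : ‖z‖ * (r + 1) < 1) : resolventSymbol f z = 0 := by
  rw [resolventSymbol, ite_eq_left_iff]
  intro hz₀
  refine image_eq_zero_of_notMem_tsupport fun hmem => hr.not_ge ?_
  have hre := hf hmem
  rw [mem_closedBall_zero_iff] at hre
  calc 1 = ‖z‖ * ‖z⁻¹‖ := by rw [← norm_mul, mul_inv_cancel₀ hz₀, norm_one]
    _ = ‖z‖ * ‖((z⁻¹).re : ℂ) - Complex.I‖ := by rw [← inv_eq_of_mem_resolventCircle hz hz₀]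
    _ ≤ ‖z‖ * (r + 1) := by
      gcongr
      refine (norm_sub_le _ _).trans ?_
      rw [Complex.norm_real, Complex.norm_I]
      gcongr

theorem continuousOn_resolventSymbol {f : ℝ → ℂ} (hf : Continuous f) (hc : HasCompactSupport f) :
    ContinuousOn (resolventSymbol f) resolventCircle := by
  intro z hz
  by_cases hz₀ : z = 0
  · obtain ⟨r, hr⟩ := hc.isCompact.isBounded.subset_closedBall 0
    have hsmall : ∀ᶠ w : ℂ in 𝓝 0, ‖w‖ * (r + 1) < 1 :=
      (by fun_prop : Continuous fun w : ℂ => ‖w‖ * (r + 1)).continuousAt.eventually_lt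
        continuousAt_const (by simp)
    subst hz₀
    refine continuousWithinAt_const.congr_of_eventuallyEq ?_
      (resolventSymbol_eq_zero_of_norm_mul_lt hr hz hsmall.self_of_nhds)
    filter_upwards [self_mem_nhdsWithin, nhdsWithin_le_nhds hsmall] with w hw hw'
    exact resolventSymbol_eq_zero_of_norm_mul_lt hr hw hw'
  · have h : ContinuousAt (fun w : ℂ => f (w⁻¹).re) z :=
      (hf.comp Complex.continuous_re).continuousAt.comp (continuousAt_inv₀ hz₀)
    refine (h.congr ?_).continuousWithinAt
    filter_upwards [isOpen_ne.mem_nhds hz₀] with w hw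
    rw [resolventSymbol, if_neg hw]

end ResolventSymbol

section FunCalc

variable {H : Type*} [NormedAddCommGroup H] [InnerProductSpace ℂ H] [CompleteSpace H]
  {T : H →ₗ.[ℂ] H}

theorem continuousOn_resolventSymbol_spectrum (hT : IsSelfAdjoint T) (f : C_c(ℝ, ℂ)) :
    ContinuousOn (resolventSymbol f) (spectrum ℂ (resolventOp T Complex.I)) :=
  (continuousOn_resolventSymbol f.continuous f.hasCompactSupport).mono
    (spectrum_resolventOp_I_subset hT)

/-- The continuous functional calculus `f ↦ f(T)` of a self-adjoint operator `T`, as a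
homomorphism of star algebras on the continuous functions with compact support. -/
noncomputable def funCalcHom (hT : IsSelfAdjoint T) : C_c(ℝ, ℂ) →⋆ₙₐ[ℂ] (H →L[ℂ] H) where
  toFun f := funCalc T f
  map_smul' c f := by
    rw [MonoidHom.id_apply, funCalc, funCalc, ← cfc_smul c _ _
      (continuousOn_resolventSymbol_spectrum hT f)]
    congr 1 with z
    by_cases hz : z = 0 <;> simp [resolventSymbol, hz]
  map_zero' := by
    rw [funCalc, show resolventSymbol ⇑(0 : C_c(ℝ, ℂ)) = 0 by ext z; simp [resolventSymbol]]
    exact cfc_zero ℂ _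
  map_add' f g := by
    rw [funCalc, funCalc, funCalc, ← cfc_add _ _ _ (continuousOn_resolventSymbol_spectrum hT f)
      (continuousOn_resolventSymbol_spectrum hT g)]
    congr 1 with z
    by_cases hz : z = 0 <;> simp [resolventSymbol, hz]
  map_mul' f g := by
    rw [funCalc, funCalc, funCalc, ← cfc_mul _ _ _ (continuousOn_resolventSymbol_spectrum hT f)
      (continuousOn_resolventSymbol_spectrum hT g)]
    congr 1 with z
    by_cases hz : z = 0 <;> simp [resolventSymbol, hz]
  map_star' f := by
    rw [funCalc, funCalc, ← cfc_star]
    congr 1 with z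
    by_cases hz : z = 0 <;> simp [resolventSymbol, hz]

theorem funCalcHom_apply (hT : IsSelfAdjoint T) (f : C_c(ℝ, ℂ)) :
    funCalcHom hT f = funCalc T f := rfl

theorem norm_funCalc_le (T : H →ₗ.[ℂ] H) {f : ℝ → ℂ} {C : ℝ} (hC : 0 ≤ C) (h : ∀ x, ‖f x‖ ≤ C) :
    ‖funCalc T f‖ ≤ C := by
  refine norm_cfc_le hC fun z _ => ?_
  rw [resolventSymbol]
  split_ifs
  · simpa using hC
  · exact h _

theorem ofReal_sub_I_ne_zero (x : ℝ) : (x : ℂ) - Complex.I ≠ 0 := fun h => by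
  simpa using congrArg Complex.im h

/-- The function `x ↦ (x - i)⁻¹`, to which the functional calculus of `T` assigns the resolvent
`(T - i)⁻¹`. -/
noncomputable def resolventFun : C(ℝ, ℂ) where
  toFun x := ((x : ℂ) - Complex.I)⁻¹
  continuous_toFun := by fun_prop (disch := exact ofReal_sub_I_ne_zero)

theorem resolventOp_mul_funCalc (hT : IsSelfAdjoint T) (f : C_c(ℝ, ℂ)) :
    resolventOp T Complex.I * funCalc T f = funCalc T ⇑(resolventFun • f) := by
  have hn := isStarNormal_resolventOp_I hT
  have hmul := cfc_mul (fun z : ℂ => z) (resolventSymbol f) (resolventOp T Complex.I)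
    (by fun_prop) (continuousOn_resolventSymbol_spectrum hT f)
  rw [cfc_id' ℂ _] at hmul
  rw [funCalc, ← hmul, funCalc]
  refine cfc_congr fun z hz => ?_
  by_cases hz₀ : z = 0
  · simp [resolventSymbol, hz₀]
  · have hinv := inv_eq_of_mem_resolventCircle (spectrum_resolventOp_I_subset hT hz) hz₀
    simp [resolventSymbol, hz₀, resolventFun, -Complex.inv_re, ← hinv]

end FunCalc

section Cutoff

/-- A compactly supported cutoff: it is `1` on `[-n, n]`, `0` outside `[-n - 1, n + 1]` and affine
in between. -/
noncomputable def cutoff (n : ℕ) : C_c(ℝ, ℝ) where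
  toFun x := max 0 (min 1 (n + 1 - |x|))
  hasCompactSupport' := by
    refine HasCompactSupport.intro (isCompact_closedBall (0 : ℝ) (n + 1)) fun x hx => ?_
    rw [mem_closedBall_zero_iff, Real.norm_eq_abs, not_le] at hx
    exact max_eq_left ((min_le_right _ _).trans (by linarith))

theorem cutoff_nonneg (n : ℕ) (x : ℝ) : 0 ≤ cutoff n x := le_max_left _ _

theorem cutoff_le_one (n : ℕ) (x : ℝ) : cutoff n x ≤ 1 :=
  max_le zero_le_one (min_le_left _ _)

theorem cutoff_eq_one {n : ℕ} {x : ℝ} (h : |x| ≤ n) : cutoff n x = 1 := by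
  change max 0 (min 1 ((n : ℝ) + 1 - |x|)) = 1
  rw [min_eq_left (by linarith), max_eq_right zero_le_one]

/-- A real function with compact support, regarded as a complex one. -/
noncomputable def complexify (f : C_c(ℝ, ℝ)) : C_c(ℝ, ℂ) :=
  f.compLeft ⟨Complex.ofReal, Complex.continuous_ofReal⟩

@[simp]
theorem complexify_apply (f : C_c(ℝ, ℝ)) (x : ℝ) : complexify f x = f x :=
  CompactlySupportedContinuousMap.compLeft_apply (by simp) f x

variable {H : Type*} [NormedAddCommGroup H] [InnerProductSpace ℂ H] [CompleteSpace H]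
  {T : H →ₗ.[ℂ] H}

theorem norm_funCalc_cutoff_le (T : H →ₗ.[ℂ] H) (n : ℕ) :
    ‖funCalc T (complexify (cutoff n))‖ ≤ 1 := by
  refine norm_funCalc_le T zero_le_one fun x => ?_
  rw [complexify_apply, Complex.norm_real, Real.norm_of_nonneg (cutoff_nonneg n x)]
  exact cutoff_le_one n x

theorem norm_one_sub_cutoff_mul_le {n : ℕ} (hn : 0 < n) (z : ℂ) :
    ‖(1 - cutoff n (z⁻¹).re : ℂ) * z‖ ≤ 1 / n := by
  have hn' : (0 : ℝ) < n := Nat.cast_pos.2 hn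
  by_cases hx : |(z⁻¹).re| ≤ n
  · rw [cutoff_eq_one hx]
    simp
  have hz : ‖z‖ ≤ 1 / n := by
    have hz' : (n : ℝ) ≤ ‖z‖⁻¹ := by
      rw [← norm_inv]
      exact (not_le.1 hx).le.trans (Complex.abs_re_le_norm _)
    rw [one_div]
    exact le_inv_of_le_inv₀ hn' hz'
  have hc : ‖(1 - cutoff n (z⁻¹).re : ℂ)‖ ≤ 1 := by
    rw [← Complex.ofReal_one, ← Complex.ofReal_sub, Complex.norm_real,
      Real.norm_of_nonneg (sub_nonneg.2 (cutoff_le_one _ _))]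
    linarith [cutoff_nonneg n (z⁻¹).re]
  calc ‖(1 - cutoff n (z⁻¹).re : ℂ) * z‖ ≤ 1 * ‖z‖ := by rw [norm_mul]; gcongr
    _ ≤ 1 / n := by rwa [one_mul]

theorem norm_resolventOp_sub_le (hT : IsSelfAdjoint T) {n : ℕ} (hn : 0 < n) :
    ‖resolventOp T Complex.I - funCalc T (complexify (cutoff n)) * resolventOp T Complex.I‖ ≤
      1 / n := by
  have hR := isStarNormal_resolventOp_I hT
  have hs := continuousOn_resolventSymbol_spectrum hT (complexify (cutoff n))
  have h := cfc_sub (fun z : ℂ => z) (fun z => resolventSymbol (complexify (cutoff n)) z * z)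
    (resolventOp T Complex.I) (by fun_prop) (hs.mul continuousOn_id)
  rw [cfc_mul (resolventSymbol _) (fun z : ℂ => z) _ hs (by fun_prop), cfc_id' ℂ _] at h
  rw [funCalc, ← h]
  refine norm_cfc_le (by positivity) fun z _ => ?_
  by_cases hz₀ : z = 0
  · simp [hz₀]
  · simpa [resolventSymbol, hz₀, sub_mul] using norm_one_sub_cutoff_mul_le hn z

theorem denseRange_resolventOp (hT : IsSelfAdjoint T) {z : ℂ} (hz : z.im ≠ 0) :
    DenseRange (resolventOp T z) :=
  hT.dense_domain.mono fun x hx =>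
    ⟨T ⟨x, hx⟩ - z • x, (isResolventAt_resolventOp hT hz _ _).2 ⟨hx, rfl⟩⟩

theorem tendsto_funCalc_cutoff (hT : IsSelfAdjoint T) (v : H) :
    Tendsto (fun n => funCalc T (complexify (cutoff n)) v) atTop (𝓝 v) := by
  have hequi : Equicontinuous fun n v => funCalc T (complexify (cutoff n)) v :=
    (LipschitzWith.uniformEquicontinuous _ 1 fun n =>
      (funCalc T _).lipschitz.weaken (norm_funCalc_cutoff_le T n)).equicontinuous
  refine (hequi.isClosed_setOfPred_tendsto continuous_id').closure_subset_iff.2 ?_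
    (denseRange_resolventOp hT (z := Complex.I) (by simp) v)
  rintro _ ⟨y, rfl⟩
  refine tendsto_iff_norm_sub_tendsto_zero.2 (squeeze_zero' (.of_forall fun _ => norm_nonneg _)
    ?_ (by simpa using (tendsto_one_div_atTop_nhds_zero_nat (𝕜 := ℝ)).mul_const ‖y‖))
  filter_upwards [eventually_gt_atTop 0] with n hn
  rw [norm_sub_rev, ← one_div]
  exact (resolventOp T Complex.I - funCalc T _ * resolventOp T Complex.I).le_of_opNorm_le
    (norm_resolventOp_sub_le hT hn) y

end Cutoff

section Reduces

variable {H : Type*} [NormedAddCommGroup H] [InnerProductSpace ℂ H]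

/-- The subspace `K` reduces the unbounded operator `T`, i.e. `T` splits along `K ⊕ Kᗮ`: the
orthogonal projection onto `K` maps the domain of `T` to itself and commutes with `T` there. In
terms of the graph, the projection preserves it. -/
def Reduces (T : H →ₗ.[ℂ] H) (K : Submodule ℂ H) [K.HasOrthogonalProjection] : Prop :=
  ∀ x y : H, (x, y) ∈ T.graph → (K.starProjection x, K.starProjection y) ∈ T.graph

theorem Reduces.orthogonal {T : H →ₗ.[ℂ] H} {K : Submodule ℂ H} [K.HasOrthogonalProjection]
    (hK : Reduces T K) : Reduces T Kᗮ := fun x y hxy => by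
  simpa [K.starProjection_orthogonal'] using T.graph.sub_mem hxy (hK x y hxy)

variable [CompleteSpace H]

theorem commute_starProjection_iff {K : Submodule ℂ H} [K.HasOrthogonalProjection]
    {A : H →L[ℂ] H} : Commute K.starProjection A ↔
      (∀ x ∈ K, A x ∈ K) ∧ ∀ x ∈ K, (star A) x ∈ K := by
  rw [ContinuousLinearMap.IsIdempotentElem.commute_iff K.isIdempotentElem_starProjection,
    Submodule.range_starProjection, Submodule.ker_starProjection,
    ← ContinuousLinearMap.mem_invtSubmodule_adjoint_iff]
  rfl

variable {T : H →ₗ.[ℂ] H} {K : Submodule ℂ H} [K.HasOrthogonalProjection]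

theorem reduces_iff_commute_resolventOp (hT : IsSelfAdjoint T) {z : ℂ} (hz : z.im ≠ 0) :
    Reduces T K ↔ Commute K.starProjection (resolventOp T z) := by
  constructor
  · intro h
    ext y
    have hy := h _ _ (resolventOp_mem_graph hT hz y)
    rw [map_add, map_smul, ← resolventOp_eq_iff hT hz] at hy
    exact hy.symm
  · intro h x y hxy
    have hx : resolventOp T z (y - z • x) = x := by
      rw [resolventOp_eq_iff hT hz, sub_add_cancel]
      exact hxy
    have hPx : resolventOp T z (K.starProjection (y - z • x)) = K.starProjection x := by
      conv_rhs => rw [← hx]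
      exact (DFunLike.congr_fun h.eq (y - z • x)).symm
    rw [resolventOp_eq_iff hT hz, map_sub, map_smul, sub_add_cancel] at hPx
    exact hPx

theorem reduces_iff_forall_commute_funCalc (hT : IsSelfAdjoint T) :
    Reduces T K ↔ ∀ f : C_c(ℝ, ℂ), Commute K.starProjection (funCalc T f) := by
  rw [reduces_iff_commute_resolventOp hT (z := Complex.I) (by simp)]
  refine ⟨fun h f => ?_, fun h => ?_⟩
  · have hstar := h.star_star
    rw [(isSelfAdjoint_starProjection K).star_eq] at hstar
    exact (h.symm.cfc hstar.symm (resolventSymbol f)).symm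
  · have hlim : ∀ v, Tendsto (fun n => funCalc T ⇑(resolventFun • complexify (cutoff n)) v)
        atTop (𝓝 (resolventOp T Complex.I v)) := fun v => by
      simp only [← resolventOp_mul_funCalc hT]
      exact ((resolventOp T Complex.I).continuous.tendsto v).comp (tendsto_funCalc_cutoff hT v)
    ext v
    refine tendsto_nhds_unique ((K.starProjection.continuous.tendsto _).comp (hlim v)) ?_
    refine (hlim (K.starProjection v)).congr fun n => ?_
    exact (DFunLike.congr_fun (h _).eq v).symm

end Reduces

section Orbit

variable {H : Type*} [NormedAddCommGroup H] [InnerProductSpace ℂ H] [CompleteSpace H]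
  {T : H →ₗ.[ℂ] H} {S : Set H}

theorem isClosed_orbit (T : H →ₗ.[ℂ] H) (S : Set H) : IsClosed (orbit T S : Set H) :=
  Submodule.isClosed_topologicalClosure _

instance (T : H →ₗ.[ℂ] H) (S : Set H) : (orbit T S).HasOrthogonalProjection :=
  have : CompleteSpace (orbit T S) := (isClosed_orbit T S).completeSpace_coe
  inferInstance

theorem funCalc_mem_orbit (f : C_c(ℝ, ℂ)) {w : H} (hw : w ∈ S) : funCalc T f w ∈ orbit T S :=
  Submodule.le_topologicalClosure _
    (Submodule.subset_span ⟨f, f.continuous, f.hasCompactSupport, w, hw, rfl⟩)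

theorem orbit_le_iff {K : Submodule ℂ H} (hK : IsClosed (K : Set H)) :
    orbit T S ≤ K ↔ ∀ f : C_c(ℝ, ℂ), ∀ w ∈ S, funCalc T f w ∈ K := by
  refine ⟨fun h f w hw => h (funCalc_mem_orbit f hw), fun h => ?_⟩
  refine Submodule.topologicalClosure_minimal _ (Submodule.span_le.2 ?_) hK
  rintro _ ⟨f, hf, hc, w, hw, rfl⟩
  exact h ⟨⟨f, hf⟩, hc⟩ w hw

theorem subset_orbit (hT : IsSelfAdjoint T) (S : Set H) : S ⊆ orbit T S := fun w hw =>
  (isClosed_orbit T S).mem_of_tendsto (tendsto_funCalc_cutoff hT w)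
    (.of_forall fun _ => funCalc_mem_orbit _ hw)

theorem reduces_orbit (hT : IsSelfAdjoint T) (S : Set H) : Reduces T (orbit T S) := by
  rw [reduces_iff_forall_commute_funCalc hT]
  have hinv : ∀ f : C_c(ℝ, ℂ), ∀ x ∈ orbit T S, funCalc T f x ∈ orbit T S := fun f =>
    (orbit_le_iff (K := (orbit T S).comap (funCalc T f : H →ₗ[ℂ] H))
      ((isClosed_orbit T S).preimage (funCalc T f).continuous)).2 fun g w hw => by
        have hmul : funCalc T (f * g) = funCalc T f * funCalc T g := map_mul (funCalcHom hT) f g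
        have hmem : funCalc T (f * g) w ∈ orbit T S := funCalc_mem_orbit (f * g) hw
        rwa [hmul] at hmem
  intro f
  have hstar : star (funCalc T f) = funCalc T (star f) := (map_star (funCalcHom hT) f).symm
  exact commute_starProjection_iff.2 ⟨hinv f, by rw [hstar]; exact hinv (star f)⟩

theorem orbit_le_of_reduces (hT : IsSelfAdjoint T) {K : Submodule ℂ H} [K.HasOrthogonalProjection]
    (hK : Reduces T K) (hS : S ⊆ K) : orbit T S ≤ K := by
  refine (orbit_le_iff (K.orthogonal_orthogonal ▸ Kᗮ.isClosed_orthogonal)).2 fun f w hw => ?_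
  exact (commute_starProjection_iff.1 ((reduces_iff_forall_commute_funCalc hT).1 hK f)).1 w (hS hw)

end Orbit

section OrthogonalSum

variable {H : Type*} [NormedAddCommGroup H] [InnerProductSpace ℂ H]
  {H₁ : Submodule ℂ H} [H₁.HasOrthogonalProjection]

theorem coe_add_coe_orthogonal (x : H) :
    (H₁.orthogonalProjectionOnto x : H) + (H₁ᗮ.orthogonalProjectionOnto x : H) = x :=
  H₁.starProjection_add_starProjection_orthogonal x

theorem orthogonalProjectionOnto_add_coe (x₁ : H₁) (x₂ : H₁ᗮ) :
    H₁.orthogonalProjectionOnto ((x₁ : H) + x₂) = x₁ := by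
  simp [Submodule.orthogonalProjectionOnto_apply_of_mem_orthogonal x₂.2]

theorem orthogonal_orthogonalProjectionOnto_add_coe (x₁ : H₁) (x₂ : H₁ᗮ) :
    H₁ᗮ.orthogonalProjectionOnto ((x₁ : H) + x₂) = x₂ := by
  simp [Submodule.orthogonalProjectionOnto_orthogonal_apply_eq_zero x₁.2]

/-- The orthogonal sum `H₁ ⊕ K₂` with a subspace `K₂` of the orthogonal complement of `H₁`. -/
noncomputable def orthogonalSum (K₂ : Submodule ℂ H₁ᗮ) : Submodule ℂ H :=
  K₂.comap (H₁ᗮ.orthogonalProjectionOnto : H →ₗ[ℂ] H₁ᗮ)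

theorem mem_orthogonalSum {K₂ : Submodule ℂ H₁ᗮ} {x : H} :
    x ∈ orthogonalSum K₂ ↔ H₁ᗮ.orthogonalProjectionOnto x ∈ K₂ := Iff.rfl

theorem le_orthogonalSum (K₂ : Submodule ℂ H₁ᗮ) : H₁ ≤ orthogonalSum K₂ := fun x hx => by
  rw [mem_orthogonalSum, Submodule.orthogonalProjectionOnto_orthogonal_apply_eq_zero hx]
  exact K₂.zero_mem

theorem comap_subtype_orthogonalSum (K₂ : Submodule ℂ H₁ᗮ) :
    (orthogonalSum K₂).comap H₁ᗮ.subtype = K₂ := by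
  ext x
  simp [mem_orthogonalSum]

theorem orthogonalSum_comap_subtype {K : Submodule ℂ H} (hK : H₁ ≤ K) :
    orthogonalSum (K.comap H₁ᗮ.subtype) = K := by
  ext x
  conv_rhs => rw [← coe_add_coe_orthogonal (H₁ := H₁) x]
  exact (K.add_mem_iff_right (hK (SetLike.coe_mem _))).symm

section

variable (K₂ : Submodule ℂ H₁ᗮ) [K₂.HasOrthogonalProjection]

theorem add_starProjection_mem_orthogonalSum (x₁ : H₁) (x₂ : H₁ᗮ) :
    (x₁ : H) + K₂.starProjection x₂ ∈ orthogonalSum K₂ := by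
  rw [mem_orthogonalSum, orthogonal_orthogonalProjectionOnto_add_coe]
  exact K₂.starProjection_apply_mem x₂

theorem sub_starProjection_mem_orthogonal_orthogonalSum (x₁ : H₁) (x₂ : H₁ᗮ) :
    (x₁ : H) + x₂ - (x₁ + K₂.starProjection x₂) ∈ (orthogonalSum K₂)ᗮ := by
  intro u hu
  have h := Submodule.inner_right_of_mem_orthogonal (mem_orthogonalSum.1 hu)
    (K₂.sub_starProjection_mem_orthogonal x₂)
  rwa [Submodule.inner_orthogonalProjectionOnto_eq_of_mem_right, Submodule.coe_sub,
    ← add_sub_add_left_eq_sub] at h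

instance : (orthogonalSum K₂).HasOrthogonalProjection where
  exists_orthogonal x := by
    refine ⟨_, add_starProjection_mem_orthogonalSum K₂ (H₁.orthogonalProjectionOnto x)
      (H₁ᗮ.orthogonalProjectionOnto x), ?_⟩
    conv => enter [2, 1]; rw [← coe_add_coe_orthogonal (H₁ := H₁) x]
    exact sub_starProjection_mem_orthogonal_orthogonalSum K₂ _ _

theorem starProjection_orthogonalSum (x₁ : H₁) (x₂ : H₁ᗮ) :
    (orthogonalSum K₂).starProjection ((x₁ : H) + x₂) = x₁ + K₂.starProjection x₂ :=
  Submodule.eq_starProjection_of_mem_orthogonal (add_starProjection_mem_orthogonalSum K₂ x₁ x₂)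
    (sub_starProjection_mem_orthogonal_orthogonalSum K₂ x₁ x₂)

end

end OrthogonalSum

section Block

variable {H : Type*} [NormedAddCommGroup H] [InnerProductSpace ℂ H]

theorem mem_graph_compression_iff {T : H →ₗ.[ℂ] H} {K : Submodule ℂ H}
    [K.HasOrthogonalProjection] {x y : K} : (x, y) ∈ (compression T K).graph ↔
      ∃ v, ((x : H), v) ∈ T.graph ∧ K.orthogonalProjectionOnto v = y := by
  rw [LinearPMap.mem_graph_iff]
  constructor
  · rintro ⟨⟨x, hx⟩, rfl, rfl⟩
    exact ⟨T ⟨x, hx⟩, T.mem_graph ⟨_, hx⟩, rfl⟩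
  · rintro ⟨v, hv, rfl⟩
    have hx : (x : H) ∈ T.domain := LinearPMap.mem_domain_of_mem_graph hv
    rw [T.mem_graph_snd_inj hv (T.mem_graph ⟨x, hx⟩) rfl]
    exact ⟨⟨x, hx⟩, rfl, rfl⟩

theorem dense_comap_subtype {K D : Submodule ℂ H} [K.HasOrthogonalProjection]
    (hD : Dense (D : Set H)) (h : ∀ x ∈ D, K.starProjection x ∈ D) :
    Dense (D.comap K.subtype : Set K) := by
  have hs : Function.Surjective K.orthogonalProjectionOnto := fun a =>
    ⟨a, K.orthogonalProjectionOnto_mem_subspace_eq_self a⟩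
  refine (hs.denseRange.dense_image K.orthogonalProjectionOnto.continuous hD).mono ?_
  rintro _ ⟨x, hx, rfl⟩
  exact h x hx

theorem range_adjoint_le_iff {E F : Type*} [NormedAddCommGroup E] [InnerProductSpace ℂ E]
    [CompleteSpace E] [NormedAddCommGroup F] [InnerProductSpace ℂ F] [CompleteSpace F]
    {A : E →L[ℂ] F} {K : Submodule ℂ E} [K.HasOrthogonalProjection] :
    (ContinuousLinearMap.adjoint A).range ≤ K ↔ ∀ x, A (K.starProjection x) = A x := by
  constructor
  · intro h x
    refine ext_inner_left ℂ fun y => ?_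
    have hy : ContinuousLinearMap.adjoint A y ∈ K := h ⟨y, rfl⟩
    rw [← ContinuousLinearMap.adjoint_inner_left A, ← ContinuousLinearMap.adjoint_inner_left A,
      ← K.inner_starProjection_left_eq_right, K.starProjection_eq_self_iff.2 hy]
  · rintro h _ ⟨y, rfl⟩
    refine K.starProjection_eq_self_iff.1 (ext_inner_right ℂ fun x => ?_)
    rw [K.inner_starProjection_left_eq_right]
    simp only [ContinuousLinearMap.coe_coe, ContinuousLinearMap.adjoint_inner_left, h]

theorem inner_coupling_add_eq_iff {H₁ : Submodule ℂ H} {Γ : H₁ᗮ →L[ℂ] H₁} (x v y w : H₁ᗮ) :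
    ⟪(Γ x : H) + v, (y : H)⟫_ℂ = ⟪(x : H), (Γ y : H) + w⟫_ℂ ↔ ⟪v, y⟫_ℂ = ⟪x, w⟫_ℂ := by
  rw [inner_add_left, inner_add_right, Submodule.inner_right_of_mem_orthogonal (Γ x).2 y.2,
    Submodule.inner_left_of_mem_orthogonal (Γ y).2 x.2, zero_add, zero_add,
    Submodule.coe_inner, Submodule.coe_inner]

instance [CompleteSpace H] (T : H →ₗ.[ℂ] H) (H₁ : Submodule ℂ H) :
    (coupledComponent T H₁).HasOrthogonalProjection :=
  have : IsClosed (coupledComponent T H₁ : Set H₁ᗮ) :=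
    (isClosed_orbit T (H₁ : Set H)).preimage continuous_subtype_val
  have : CompleteSpace (coupledComponent T H₁) := this.completeSpace_coe
  inferInstance

theorem reduces_orthogonalSum_coupledComponent [CompleteSpace H] {T : H →ₗ.[ℂ] H}
    {H₁ : Submodule ℂ H} [CompleteSpace H₁] (hT : IsSelfAdjoint T) :
    Reduces T (orthogonalSum (coupledComponent T H₁)) := by
  have hK : ∀ (K : Submodule ℂ H) [K.HasOrthogonalProjection], K = minimalExtension T H₁ →
      Reduces T K := by
    rintro _ _ rfl
    exact reduces_orbit hT _
  exact hK _ (orthogonalSum_comap_subtype (subset_orbit hT _))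

namespace HasBoundedCoupling

section Column

variable {T : H →ₗ.[ℂ] H} {H₁ : Submodule ℂ H} [H₁.HasOrthogonalProjection] {Γ : H₁ᗮ →L[ℂ] H₁}

theorem apply_eq_of_mem_graph (hΓ : HasBoundedCoupling T H₁ Γ) {x : H₁ᗮ} {y : H}
    (hx : ((x : H), y) ∈ T.graph) : Γ x = H₁.orthogonalProjectionOnto y := by
  have hx' : (x : H) ∈ T.domain := LinearPMap.mem_domain_of_mem_graph hx
  rw [T.mem_graph_snd_inj hx (T.mem_graph ⟨x, hx'⟩) rfl]
  exact hΓ.coupling_apply x hx'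

theorem mem_graph_compression_iff (hΓ : HasBoundedCoupling T H₁ Γ) {x y : H₁ᗮ} :
    (x, y) ∈ (compression T H₁ᗮ).graph ↔ ((x : H), (Γ x : H) + y) ∈ T.graph := by
  rw [OpenSystem.mem_graph_compression_iff]
  constructor
  · rintro ⟨v, hv, rfl⟩
    rwa [hΓ.apply_eq_of_mem_graph hv, coe_add_coe_orthogonal]
  · exact fun h => ⟨_, h, orthogonal_orthogonalProjectionOnto_add_coe _ _⟩

theorem exists_columns (hΓ : HasBoundedCoupling T H₁ Γ) {x y : H} (hxy : (x, y) ∈ T.graph) :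
    ∃ (x₁ : H₁) (y₁ : H) (x₂ y₂ : H₁ᗮ), ((x₁ : H), y₁) ∈ T.graph ∧
      (x₂, y₂) ∈ (compression T H₁ᗮ).graph ∧
      (x : H) = x₁ + x₂ ∧ y = y₁ + ((Γ x₂ : H) + y₂) := by
  have h₁ := T.mem_graph ⟨_, hΓ.proj_mem_domain x (LinearPMap.mem_domain_of_mem_graph hxy)⟩
  set y₁ : H := T ⟨_, hΓ.proj_mem_domain x (LinearPMap.mem_domain_of_mem_graph hxy)⟩
  have h₂ : ((H₁ᗮ.orthogonalProjectionOnto x : H), y - y₁) ∈ T.graph := by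
    have h := T.graph.sub_mem hxy h₁
    rwa [Prod.mk_sub_mk, ← Submodule.starProjection_orthogonal_val] at h
  refine ⟨H₁.orthogonalProjectionOnto x, y₁, _, _, h₁,
    OpenSystem.mem_graph_compression_iff.2 ⟨_, h₂, rfl⟩, (coe_add_coe_orthogonal x).symm, ?_⟩
  rw [hΓ.apply_eq_of_mem_graph h₂, coe_add_coe_orthogonal, add_sub_cancel]

theorem dense_domain_compression [CompleteSpace H] (hT : IsSelfAdjoint T)
    (hΓ : HasBoundedCoupling T H₁ Γ) : Dense ((compression T H₁ᗮ).domain : Set H₁ᗮ) :=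
  dense_comap_subtype hT.dense_domain fun x hx => by
    rw [Submodule.starProjection_orthogonal_val]
    exact T.domain.sub_mem hx (hΓ.proj_mem_domain x hx)

end Column

variable [CompleteSpace H] {T : H →ₗ.[ℂ] H} {H₁ : Submodule ℂ H} [CompleteSpace H₁]
  {Γ : H₁ᗮ →L[ℂ] H₁}

theorem adjoint_apply_eq_of_mem_graph (hT : IsSelfAdjoint T) (hΓ : HasBoundedCoupling T H₁ Γ)
    {x : H₁} {y : H} (hx : ((x : H), y) ∈ T.graph) :
    ContinuousLinearMap.adjoint Γ x = H₁ᗮ.orthogonalProjectionOnto y := by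
  refine (hΓ.dense_domain_compression hT).eq_of_inner_left ℂ fun u hu => ?_
  have hv : ((u : H), T ⟨u, hu⟩) ∈ T.graph := T.mem_graph ⟨u, hu⟩
  rw [Submodule.inner_orthogonalProjectionOnto_eq_of_mem_right,
    ContinuousLinearMap.adjoint_inner_left, hΓ.apply_eq_of_mem_graph hv,
    Submodule.inner_orthogonalProjectionOnto_eq_of_mem_left]
  exact (inner_eq_of_mem_graph hT hx hv).symm

theorem inner_column_eq (hT : IsSelfAdjoint T) (hΓ : HasBoundedCoupling T H₁ Γ)
    {x₁ : H₁} {y₁ : H} (h₁ : ((x₁ : H), y₁) ∈ T.graph) (y₂ w : H₁ᗮ) :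
    ⟪y₁, (y₂ : H)⟫_ℂ = ⟪(x₁ : H), (Γ y₂ : H) + w⟫_ℂ := by
  rw [inner_add_right, Submodule.inner_right_of_mem_orthogonal x₁.2 w.2, add_zero,
    ← Submodule.inner_orthogonalProjectionOnto_eq_of_mem_right,
    ← hΓ.adjoint_apply_eq_of_mem_graph hT h₁, ContinuousLinearMap.adjoint_inner_left,
    Submodule.coe_inner]

theorem isSelfAdjoint_compression (hT : IsSelfAdjoint T) (hΓ : HasBoundedCoupling T H₁ Γ) :
    IsSelfAdjoint (compression T H₁ᗮ) := by
  refine (isSelfAdjoint_iff_mem_graph (T := compression T H₁ᗮ)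
    (hΓ.dense_domain_compression hT)).2 fun y w => ?_
  rw [hΓ.mem_graph_compression_iff, mem_graph_iff_of_isSelfAdjoint hT]
  constructor
  · intro h x v hxv
    exact (inner_coupling_add_eq_iff x v y w).1 (h _ _ (hΓ.mem_graph_compression_iff.1 hxv))
  · intro h x v hxv
    obtain ⟨x₁, y₁, x₂, y₂, h₁, h₂, rfl, rfl⟩ := hΓ.exists_columns hxv
    rw [inner_add_left, inner_add_left (x₁ : H), hΓ.inner_column_eq hT h₁ y w,
      (inner_coupling_add_eq_iff x₂ y₂ y w).2 (h x₂ y₂ h₂)]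

theorem reduces_orthogonalSum_iff (hT : IsSelfAdjoint T) (hΓ : HasBoundedCoupling T H₁ Γ)
    {K₂ : Submodule ℂ H₁ᗮ} [K₂.HasOrthogonalProjection] :
    Reduces T (orthogonalSum K₂) ↔
      Reduces (compression T H₁ᗮ) K₂ ∧ (ContinuousLinearMap.adjoint Γ).range ≤ K₂ := by
  have hP := starProjection_orthogonalSum K₂
  have hP₂ : ∀ x : H₁ᗮ,
      (orthogonalSum K₂).starProjection (x : H) = (K₂.starProjection x : H₁ᗮ) :=
    fun x => by simpa using hP 0 x
  rw [range_adjoint_le_iff]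
  constructor
  · intro h
    have hred : ∀ x y, (x, y) ∈ (compression T H₁ᗮ).graph →
        (((K₂.starProjection x : H₁ᗮ) : H), (Γ x : H) + (K₂.starProjection y : H₁ᗮ)) ∈ T.graph :=
      fun x y hxy => by
        simpa only [hP, hP₂] using h _ _ (hΓ.mem_graph_compression_iff.1 hxy)
    refine ⟨fun x y hxy => OpenSystem.mem_graph_compression_iff.2
      ⟨_, hred x y hxy, orthogonal_orthogonalProjectionOnto_add_coe _ _⟩, fun x => ?_⟩
    refine congr_fun ((Γ.continuous.comp K₂.starProjection.continuous).ext_on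
      (hΓ.dense_domain_compression hT) Γ.continuous fun u hu => ?_) x
    rw [Function.comp_apply, hΓ.apply_eq_of_mem_graph (hred u _ (LinearPMap.mem_graph _ ⟨u, hu⟩)),
      orthogonalProjectionOnto_add_coe]
  · rintro ⟨hred, hker⟩ x y hxy
    obtain ⟨x₁, y₁, x₂, y₂, h₁, h₂, rfl, rfl⟩ := hΓ.exists_columns hxy
    have hy₁ : y₁ ∈ orthogonalSum K₂ := by
      rw [mem_orthogonalSum, ← hΓ.adjoint_apply_eq_of_mem_graph hT h₁]
      exact range_adjoint_le_iff.2 hker ⟨x₁, rfl⟩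
    rw [hP, map_add, hP, Submodule.starProjection_eq_self_iff.2 hy₁, ← hker]
    exact T.graph.add_mem h₁ (hΓ.mem_graph_compression_iff.1 (hred _ _ h₂))

theorem coupledComponent_eq (hT : IsSelfAdjoint T) (hΓ : HasBoundedCoupling T H₁ Γ) :
    coupledComponent T H₁ =
      orbit (compression T H₁ᗮ) ((ContinuousLinearMap.adjoint Γ).range : Set H₁ᗮ) := by
  have hT₂ := hΓ.isSelfAdjoint_compression hT
  refine le_antisymm ?_ ?_
  · rw [← comap_subtype_orthogonalSum (orbit (compression T H₁ᗮ) _)]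
    exact Submodule.comap_mono (orbit_le_of_reduces hT
      ((hΓ.reduces_orthogonalSum_iff hT).2 ⟨reduces_orbit hT₂ _, subset_orbit hT₂ _⟩)
      (le_orthogonalSum _))
  · obtain ⟨hred, hrange⟩ := (hΓ.reduces_orthogonalSum_iff hT).1
      (reduces_orthogonalSum_coupledComponent hT)
    exact orbit_le_of_reduces hT₂ hred hrange

end HasBoundedCoupling

end Block

section SpectralMeasure

theorem complexify_add (f g : C_c(ℝ, ℝ)) : complexify (f + g) = complexify f + complexify g := by
  ext; simp

theorem complexify_smul (c : ℝ) (f : C_c(ℝ, ℝ)) :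
    complexify (c • f) = (c : ℂ) • complexify f := by
  ext; simp

theorem star_complexify (f : C_c(ℝ, ℝ)) : star (complexify f) = complexify f := by
  ext; simp

theorem exists_eq_complexify_add (f : C_c(ℝ, ℂ)) :
    ∃ u w : C_c(ℝ, ℝ), f = complexify u + Complex.I • complexify w := by
  refine ⟨f.compLeft ⟨Complex.re, Complex.continuous_re⟩,
    f.compLeft ⟨Complex.im, Complex.continuous_im⟩, ?_⟩
  ext x
  simp [CompactlySupportedContinuousMap.compLeft_apply, mul_comm Complex.I]

theorem exists_star_mul_self_eq_complexify {f : C_c(ℝ, ℝ)} (hf : 0 ≤ f) :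
    ∃ g : C_c(ℝ, ℂ), star g * g = complexify f := by
  refine ⟨complexify (f.compLeft ⟨Real.sqrt, Real.continuous_sqrt⟩), ?_⟩
  ext x
  rw [star_complexify, CompactlySupportedContinuousMap.mul_apply, complexify_apply,
    complexify_apply, ← Complex.ofReal_mul,
    CompactlySupportedContinuousMap.compLeft_apply (by simp)]
  exact congrArg Complex.ofReal (Real.mul_self_sqrt (hf x))

theorem memLp_compactlySupported (μ : Measure ℝ) [IsFiniteMeasureOnCompacts μ] (f : C_c(ℝ, ℂ))
    (p : ℝ≥0∞) : MemLp f p μ :=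
  f.continuous.memLp_of_hasCompactSupport f.hasCompactSupport

theorem tendsto_lintegral_cutoff (μ : Measure ℝ) :
    Tendsto (fun n => ∫⁻ x, ENNReal.ofReal (cutoff n x) ∂μ) atTop (𝓝 (μ Set.univ)) := by
  rw [← lintegral_one]
  refine lintegral_tendsto_of_tendsto_of_monotone
    (fun n => (map_continuous (cutoff n)).measurable.ennreal_ofReal.aemeasurable)
    (.of_forall fun x n m hnm => ?_) (.of_forall fun x => ?_)
  · refine ENNReal.ofReal_le_ofReal (max_le_max le_rfl (min_le_min le_rfl ?_))
    gcongr
  · obtain ⟨N, hN⟩ := exists_nat_ge |x|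
    refine tendsto_const_nhds.congr' ?_
    filter_upwards [eventually_ge_atTop N] with n hn
    rw [cutoff_eq_one (hN.trans (by exact_mod_cast hn)), ENNReal.ofReal_one]

variable {H : Type*} [NormedAddCommGroup H] [InnerProductSpace ℂ H] [CompleteSpace H]
  {T : H →ₗ.[ℂ] H}

theorem inner_funCalc_star_mul_self (hT : IsSelfAdjoint T) (f : C_c(ℝ, ℂ)) (v : H) :
    ⟪v, funCalc T ⇑(star f * f) v⟫_ℂ = ((‖funCalc T f v‖ ^ 2 : ℝ) : ℂ) := by
  rw [← funCalcHom_apply hT, map_mul, map_star, ContinuousLinearMap.star_eq_adjoint,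
    mul_apply_eq_comp, ContinuousLinearMap.adjoint_inner_right,
    inner_self_eq_norm_sq_to_K, Complex.ofReal_pow]
  rfl

theorem im_inner_funCalc_complexify (hT : IsSelfAdjoint T) (f : C_c(ℝ, ℝ)) (v : H) :
    (⟪v, funCalc T (complexify f) v⟫_ℂ).im = 0 := by
  rw [← Complex.conj_eq_iff_im, inner_conj_symm, ← ContinuousLinearMap.adjoint_inner_right,
    ← ContinuousLinearMap.star_eq_adjoint, ← funCalcHom_apply hT, ← map_star, star_complexify]

/-- The positive functional `f ↦ ⟪v, f(T) v⟫` on the continuous functions with compact support. -/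
noncomputable def spectralFunctional (hT : IsSelfAdjoint T) (v : H) : C_c(ℝ, ℝ) →ₚ[ℝ] ℝ :=
  PositiveLinearMap.mk₀
    { toFun f := (⟪v, funCalcHom hT (complexify f) v⟫_ℂ).re
      map_add' f g := by simp [complexify_add]
      map_smul' c f := by simp [complexify_smul] }
    fun f hf => by
      obtain ⟨g, hg⟩ := exists_star_mul_self_eq_complexify hf
      change 0 ≤ (⟪v, funCalcHom hT (complexify f) v⟫_ℂ).re
      rw [← hg, funCalcHom_apply, inner_funCalc_star_mul_self hT, Complex.ofReal_re]
      positivity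

/-- The spectral measure of the vector `v` for the self-adjoint operator `T`, which represents
the functional `f ↦ ⟪v, f(T) v⟫`. -/
noncomputable def spectralMeasure (hT : IsSelfAdjoint T) (v : H) : Measure ℝ :=
  RealRMK.rieszMeasure (spectralFunctional hT v)

instance (hT : IsSelfAdjoint T) (v : H) : (spectralMeasure hT v).Regular :=
  RealRMK.regular_rieszMeasure _

theorem integral_real_spectralMeasure (hT : IsSelfAdjoint T) (v : H) (f : C_c(ℝ, ℝ)) :
    ∫ x, f x ∂(spectralMeasure hT v) = (⟪v, funCalc T (complexify f) v⟫_ℂ).re :=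
  RealRMK.integral_rieszMeasure (spectralFunctional hT v) f

theorem integral_complexify_spectralMeasure (hT : IsSelfAdjoint T) (v : H) (f : C_c(ℝ, ℝ)) :
    ∫ x, complexify f x ∂(spectralMeasure hT v) = ⟪v, funCalc T (complexify f) v⟫_ℂ := by
  simp only [complexify_apply, integral_complex_ofReal, integral_real_spectralMeasure]
  exact Complex.ext rfl (im_inner_funCalc_complexify hT f v).symm

theorem spectralMeasure_univ (hT : IsSelfAdjoint T) (v : H) :
    spectralMeasure hT v Set.univ = ENNReal.ofReal (‖v‖ ^ 2) := by
  have hcutoff : ∀ n, ∫⁻ x, ENNReal.ofReal (cutoff n x) ∂(spectralMeasure hT v) =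
      ENNReal.ofReal (⟪v, funCalc T (complexify (cutoff n)) v⟫_ℂ).re := fun n => by
    rw [← integral_real_spectralMeasure hT, ofReal_integral_eq_lintegral_ofReal
      ((map_continuous (cutoff n)).integrable_of_hasCompactSupport (cutoff n).hasCompactSupport)
      (.of_forall (cutoff_nonneg n))]
  have hlim : Tendsto (fun n => (⟪v, funCalc T (complexify (cutoff n)) v⟫_ℂ).re) atTop
      (𝓝 (⟪v, v⟫_ℂ).re) :=
    (Complex.continuous_re.tendsto _).comp (tendsto_const_nhds.inner (tendsto_funCalc_cutoff hT v))
  rw [show (⟪v, v⟫_ℂ).re = ‖v‖ ^ 2 from inner_self_eq_norm_sq (𝕜 := ℂ) v] at hlim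
  exact tendsto_nhds_unique (tendsto_lintegral_cutoff _)
    (by simpa only [hcutoff] using ENNReal.tendsto_ofReal hlim)

instance (hT : IsSelfAdjoint T) (v : H) : IsFiniteMeasure (spectralMeasure hT v) :=
  ⟨by rw [spectralMeasure_univ]; exact ENNReal.ofReal_lt_top⟩

theorem integral_spectralMeasure (hT : IsSelfAdjoint T) (v : H) (f : C_c(ℝ, ℂ)) :
    ∫ x, f x ∂(spectralMeasure hT v) = ⟪v, funCalc T f v⟫_ℂ := by
  have hint : ∀ u : C_c(ℝ, ℝ), Integrable (complexify u) (spectralMeasure hT v) := fun u =>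
    (complexify u).continuous.integrable_of_hasCompactSupport (complexify u).hasCompactSupport
  obtain ⟨u, w, rfl⟩ := exists_eq_complexify_add f
  rw [← funCalcHom_apply hT, map_add, map_smul, add_apply, smul_apply, inner_add_right,
    inner_smul_right, funCalcHom_apply hT, funCalcHom_apply hT,
    ← integral_complexify_spectralMeasure hT, ← integral_complexify_spectralMeasure hT,
    ← integral_const_mul, ← integral_add (hint u) ((hint w).const_mul _)]
  rfl

theorem enorm_funCalc_apply (hT : IsSelfAdjoint T) (v : H) (f : C_c(ℝ, ℂ)) :
    ‖funCalc T f v‖ₑ = eLpNorm f 2 (spectralMeasure hT v) := by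
  have hsq : ‖funCalc T f v‖ ^ 2 = ∫ x, ‖f x‖ ^ 2 ∂(spectralMeasure hT v) := by
    rw [← Complex.ofReal_inj, ← inner_funCalc_star_mul_self hT, ← integral_spectralMeasure,
      ← integral_complex_ofReal]
    exact integral_congr_ae (.of_forall fun x => by simp [Complex.conj_mul'])
  rw [(memLp_compactlySupported _ f 2).eLpNorm_eq_integral_rpow_norm two_ne_zero (by simp)]
  simp only [ENNReal.toReal_ofNat, Real.rpow_two]
  rw [← hsq, ← one_div, ← Real.sqrt_eq_rpow, Real.sqrt_sq (norm_nonneg _), ofReal_norm]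

end SpectralMeasure

section SquareIntegrableApproximation

/-- The filter of convergence to `g` in `L²(ν)` for all finite Borel measures `ν` on the line at
once, on the continuous functions with compact support. A single filter for all measures makes
limits of `f(T) v` along it linear in `v`, although the relevant measure depends on `v`. -/
noncomputable def l2Nhds (g : ℝ → ℂ) : Filter C_c(ℝ, ℂ) :=
  ⨅ ν : FiniteMeasure ℝ, comap (fun f => eLpNorm (⇑f - g) 2 (ν : Measure ℝ)) (𝓝 0)

variable {g : ℝ → ℂ}

theorem l2Nhds_neBot (hg : ∀ ν : FiniteMeasure ℝ, MemLp g 2 (ν : Measure ℝ)) :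
    (l2Nhds g).NeBot := by
  have hanti : ∀ {ν ρ : Measure ℝ}, ν ≤ ρ →
      comap (fun f : C_c(ℝ, ℂ) => eLpNorm (⇑f - g) 2 ρ) (𝓝 0) ≤
        comap (fun f : C_c(ℝ, ℂ) => eLpNorm (⇑f - g) 2 ν) (𝓝 0) := fun hνρ =>
    tendsto_iff_comap.1 (tendsto_of_tendsto_of_tendsto_of_le_of_le tendsto_const_nhds
      tendsto_comap (fun _ => zero_le) fun _ => eLpNorm_mono_measure _ hνρ)
  refine iInf_neBot_of_directed' (fun ν ρ => ⟨ν + ρ, hanti (Measure.le_add_right le_rfl),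
    hanti (Measure.le_add_left le_rfl)⟩) fun ν => comap_neBot fun t ht => ?_
  obtain ⟨ε, hε, hεt⟩ := ENNReal.nhds_zero_basis_Iic.mem_iff.1 ht
  obtain ⟨f, hf, hfg, hfc, -⟩ :=
    (hg ν).exists_hasCompactSupport_eLpNorm_sub_le (by simp) hε.ne'
  exact ⟨⟨⟨f, hfc⟩, hf⟩, hεt (by rwa [eLpNorm_sub_comm] at hfg)⟩

variable (ν : Measure ℝ) [IsFiniteMeasure ν]

theorem tendsto_eLpNorm_sub_l2Nhds (g : ℝ → ℂ) :
    Tendsto (fun f : C_c(ℝ, ℂ) => eLpNorm (⇑f - g) 2 ν) (l2Nhds g) (𝓝 0) :=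
  tendsto_comap.mono_left (iInf_le _ (⟨ν, inferInstance⟩ : FiniteMeasure ℝ))

theorem tendsto_toLp_l2Nhds (hg : MemLp g 2 ν) :
    Tendsto (fun f : C_c(ℝ, ℂ) => (memLp_compactlySupported ν f 2).toLp f) (l2Nhds g)
      (𝓝 (hg.toLp g)) :=
  (Lp.tendsto_Lp_iff_tendsto_eLpNorm'' _ _ _ hg).2 (tendsto_eLpNorm_sub_l2Nhds ν g)

theorem tendsto_integral_l2Nhds (hg : MemLp g 2 ν) :
    Tendsto (fun f : C_c(ℝ, ℂ) => ∫ x, f x ∂ν) (l2Nhds g) (𝓝 (∫ x, g x ∂ν)) := by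
  refine tendsto_integral_of_L1' g hg.1
    (.of_forall fun f => (memLp_compactlySupported ν f 2).integrable one_le_two) ?_
  refine tendsto_of_tendsto_of_tendsto_of_le_of_le tendsto_const_nhds ?_ (fun _ => zero_le)
    fun f => eLpNorm_le_eLpNorm_mul_rpow_measure_univ one_le_two
      ((memLp_compactlySupported ν f 2).1.sub hg.1)
  simpa using ENNReal.Tendsto.mul_const (tendsto_eLpNorm_sub_l2Nhds ν g)
    (.inr (ENNReal.rpow_ne_top_of_nonneg (by norm_num) (measure_ne_top ν Set.univ)))

end SquareIntegrableApproximation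

section SpectralProjection

theorem memLp_indicator_one {B : Set ℝ} (hB : MeasurableSet B) (ν : Measure ℝ)
    [IsFiniteMeasure ν] : MemLp (B.indicator (1 : ℝ → ℂ)) 2 ν :=
  memLp_indicator_const 2 hB 1 (.inr (measure_ne_top ν B))

variable {H : Type*} [NormedAddCommGroup H] [InnerProductSpace ℂ H]

theorem ext_inner_self {A B : H →L[ℂ] H} (h : ∀ v, ⟪v, A v⟫_ℂ = ⟪v, B v⟫_ℂ) : A = B :=
  ContinuousLinearMap.coe_inj.1 <| (ext_inner_map _ _).1 fun v => by
    simpa using congrArg (starRingEnd ℂ) (h v)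

variable [CompleteSpace H]

theorem ProjectionValuedMeasure.measure_apply (E : ProjectionValuedMeasure H) (v : H) {B : Set ℝ}
    (hB : MeasurableSet B) : E.measure v B = ENNReal.ofReal (⟪v, E.proj B v⟫_ℂ).re :=
  Measure.ofMeasurable_apply B hB

variable {T : H →ₗ.[ℂ] H}

theorem dist_funCalc_apply (hT : IsSelfAdjoint T) (v : H) (f g : C_c(ℝ, ℂ)) :
    dist (funCalc T f v) (funCalc T g v) =
      dist ((memLp_compactlySupported (spectralMeasure hT v) f 2).toLp f)
        ((memLp_compactlySupported (spectralMeasure hT v) g 2).toLp g) := by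
  rw [dist_edist, dist_edist, Lp.edist_toLp_toLp, edist_eq_enorm_sub, ← sub_apply,
    ← funCalcHom_apply hT, ← funCalcHom_apply hT, ← map_sub, funCalcHom_apply,
    enorm_funCalc_apply hT]
  rfl

theorem norm_funCalc_apply (hT : IsSelfAdjoint T) (v : H) (f : C_c(ℝ, ℂ)) :
    ‖funCalc T f v‖ = ‖(memLp_compactlySupported (spectralMeasure hT v) f 2).toLp f‖ := by
  rw [Lp.norm_toLp, ← enorm_funCalc_apply, toReal_enorm]

theorem exists_tendsto_funCalc_apply (hT : IsSelfAdjoint T) {g : ℝ → ℂ}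
    (hg : ∀ ν : FiniteMeasure ℝ, MemLp g 2 (ν : Measure ℝ)) (v : H) :
    ∃ y, Tendsto (fun f : C_c(ℝ, ℂ) => funCalc T f v) (l2Nhds g) (𝓝 y) := by
  have := l2Nhds_neBot hg
  have hcauchy := (tendsto_toLp_l2Nhds (spectralMeasure hT v)
    (hg ⟨spectralMeasure hT v, inferInstance⟩)).cauchy_map
  rw [cauchy_map_iff', tendsto_uniformity_iff_dist_tendsto_zero] at hcauchy
  simp_rw [← dist_funCalc_apply] at hcauchy
  exact CompleteSpace.complete
    (cauchy_map_iff'.2 (tendsto_uniformity_iff_dist_tendsto_zero.2 hcauchy))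

theorem norm_sq_eq_of_tendsto_funCalc_apply (hT : IsSelfAdjoint T) {B : Set ℝ}
    (hB : MeasurableSet B) {v y : H} (hy : Tendsto (fun f : C_c(ℝ, ℂ) => funCalc T f v)
      (l2Nhds (B.indicator 1)) (𝓝 y)) : ‖y‖ ^ 2 = (spectralMeasure hT v).real B := by
  have := l2Nhds_neBot fun ν => memLp_indicator_one hB ν
  have hL2 := (tendsto_toLp_l2Nhds (spectralMeasure hT v) (memLp_indicator_one hB _)).norm
  simp_rw [← norm_funCalc_apply] at hL2
  have hnorm : ‖(memLp_indicator_one hB (spectralMeasure hT v)).toLp _‖ =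
      √((spectralMeasure hT v).real B) :=
    (norm_indicatorConstLp (hs := hB) (hμs := measure_ne_top _ B) (c := (1 : ℂ)) two_ne_zero
      (by simp)).trans (by
      rw [norm_one, one_mul, Real.sqrt_eq_rpow, ENNReal.toReal_ofNat])
  rw [tendsto_nhds_unique hy.norm hL2, hnorm, Real.sq_sqrt measureReal_nonneg]

theorem exists_spectralProj (hT : IsSelfAdjoint T) {B : Set ℝ} (hB : MeasurableSet B) :
    ∃ P : H →L[ℂ] H, ∀ v, Tendsto (fun f : C_c(ℝ, ℂ) => funCalc T f v)
      (l2Nhds (B.indicator 1)) (𝓝 (P v)) := by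
  have := l2Nhds_neBot fun ν => memLp_indicator_one hB ν
  choose y hy using exists_tendsto_funCalc_apply hT fun ν => memLp_indicator_one hB ν
  refine ⟨(linearMapOfTendsto y (fun f : C_c(ℝ, ℂ) => (funCalc T f : H →ₗ[ℂ] H))
    (tendsto_pi_nhds.2 hy)).mkContinuous 1 fun v => ?_, hy⟩
  rw [one_mul, ← sq_le_sq₀ (norm_nonneg _) (norm_nonneg _)]
  calc ‖y v‖ ^ 2 = (spectralMeasure hT v).real B := norm_sq_eq_of_tendsto_funCalc_apply hT hB (hy v)
    _ ≤ (spectralMeasure hT v).real Set.univ := measureReal_mono (Set.subset_univ B)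
    _ = ‖v‖ ^ 2 := by
      rw [measureReal_def, spectralMeasure_univ, ENNReal.toReal_ofReal (sq_nonneg _)]

open scoped Classical in
/-- The spectral projection of the self-adjoint operator `T` for the Borel set `B` (zero for other
sets `B`): the strong limit of `f(T)` as `f` tends to the indicator function of `B`. -/
noncomputable def spectralProj (hT : IsSelfAdjoint T) (B : Set ℝ) : H →L[ℂ] H :=
  if hB : MeasurableSet B then (exists_spectralProj hT hB).choose else 0

theorem tendsto_funCalc_spectralProj (hT : IsSelfAdjoint T) {B : Set ℝ} (hB : MeasurableSet B)
    (v : H) : Tendsto (fun f : C_c(ℝ, ℂ) => funCalc T f v) (l2Nhds (B.indicator 1))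
      (𝓝 (spectralProj hT B v)) := by
  rw [spectralProj, dif_pos hB]
  exact (exists_spectralProj hT hB).choose_spec v

variable (hT : IsSelfAdjoint T) {A B : Set ℝ}

theorem inner_spectralProj_self (hB : MeasurableSet B) (v : H) :
    ⟪v, spectralProj hT B v⟫_ℂ = ((spectralMeasure hT v).real B : ℂ) := by
  have := l2Nhds_neBot fun ν => memLp_indicator_one hB ν
  have hlim := tendsto_integral_l2Nhds _ (memLp_indicator_one hB (spectralMeasure hT v))
  simp_rw [integral_spectralMeasure] at hlim
  rw [tendsto_nhds_unique (tendsto_const_nhds.inner (tendsto_funCalc_spectralProj hT hB v)) hlim,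
    integral_indicator hB]
  simp [Measure.real]

theorem norm_sq_spectralProj (hB : MeasurableSet B) (v : H) :
    ‖spectralProj hT B v‖ ^ 2 = (spectralMeasure hT v).real B :=
  norm_sq_eq_of_tendsto_funCalc_apply hT hB (tendsto_funCalc_spectralProj hT hB v)

theorem isStarProjection_spectralProj (hB : MeasurableSet B) :
    IsStarProjection (spectralProj hT B) := by
  have hstar : star (spectralProj hT B) * spectralProj hT B = spectralProj hT B :=
    ext_inner_self fun v => by
      rw [mul_apply_eq_comp, ContinuousLinearMap.star_eq_adjoint,
        ContinuousLinearMap.adjoint_inner_right, inner_self_eq_norm_sq_to_K,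
        inner_spectralProj_self hT hB, ← norm_sq_spectralProj hT hB, Complex.ofReal_pow]
      rfl
  have hself : IsSelfAdjoint (spectralProj hT B) := hstar ▸ .star_mul_self _
  rw [hself.star_eq] at hstar
  exact ⟨hstar, hself⟩

theorem spectralProj_empty : spectralProj hT ∅ = 0 :=
  ext_inner_self fun v => by simp [inner_spectralProj_self hT .empty]

theorem spectralProj_univ : spectralProj hT Set.univ = 1 :=
  ext_inner_self fun v => by
    rw [inner_spectralProj_self hT .univ, measureReal_def, spectralMeasure_univ,
      ENNReal.toReal_ofReal (sq_nonneg _), one_apply_eq_self,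
      inner_self_eq_norm_sq_to_K, Complex.ofReal_pow]
    rfl

theorem spectralProj_union (hA : MeasurableSet A) (hB : MeasurableSet B) (hAB : Disjoint A B) :
    spectralProj hT (A ∪ B) = spectralProj hT A + spectralProj hT B :=
  ext_inner_self fun v => by
    rw [add_apply, inner_add_right, inner_spectralProj_self hT (hA.union hB),
      inner_spectralProj_self hT hA, inner_spectralProj_self hT hB, measureReal_union hAB hB,
      Complex.ofReal_add]

theorem spectralProj_mul_eq_zero (hA : MeasurableSet A) (hB : MeasurableSet B)
    (hAB : Disjoint A B) : spectralProj hT A * spectralProj hT B = 0 := by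
  have hunion := spectralProj_union hT hA hB hAB
  have : IsAddTorsionFree (H →L[ℂ] H) := .of_isTorsionFree ℂ _
  -- The difference of two star projections is one only if they are nested.
  have hmul : spectralProj hT A * spectralProj hT (A ∪ B) = spectralProj hT A := by
    refine ((isStarProjection_spectralProj hT hA).sub_iff_mul_eq_left
      (isStarProjection_spectralProj hT (hA.union hB))).1 ?_
    rw [hunion, add_sub_cancel_left]
    exact isStarProjection_spectralProj hT hB
  rwa [hunion, mul_add, (isStarProjection_spectralProj hT hA).isIdempotentElem.eq,
    add_eq_left] at hmul

theorem spectralProj_inter (hA : MeasurableSet A) (hB : MeasurableSet B) :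
    spectralProj hT (A ∩ B) = spectralProj hT A * spectralProj hT B := by
  have hAB := hA.inter hB
  have hA_split := spectralProj_union hT hAB (hA.diff hB) Set.disjoint_sdiff_inter.symm
  have hB_split := spectralProj_union hT hAB (hB.diff hA)
    (Set.disjoint_sdiff_right.mono_left Set.inter_subset_left)
  rw [Set.inter_union_sdiff] at hA_split
  rw [Set.inter_comm, Set.inter_union_sdiff, Set.inter_comm] at hB_split
  rw [hA_split, hB_split, add_mul, mul_add, mul_add,
    (isStarProjection_spectralProj hT hAB).isIdempotentElem.eq,
    spectralProj_mul_eq_zero hT hAB (hB.diff hA)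
      (Set.disjoint_sdiff_right.mono_left Set.inter_subset_left),
    spectralProj_mul_eq_zero hT (hA.diff hB) hAB Set.disjoint_sdiff_inter,
    spectralProj_mul_eq_zero hT (hA.diff hB) (hB.diff hA)
      (Set.disjoint_sdiff_right.mono_left Set.sdiff_subset)]
  simp

theorem spectralProj_biUnion {ι : Type*} (s : Finset ι) {B : ι → Set ℝ}
    (hB : ∀ i, MeasurableSet (B i)) (hd : (s : Set ι).PairwiseDisjoint B) :
    spectralProj hT (⋃ i ∈ s, B i) = ∑ i ∈ s, spectralProj hT (B i) :=
  ext_inner_self fun v => by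
    rw [sum_apply, inner_sum, inner_spectralProj_self hT (s.measurableSet_biUnion fun i _ => hB i),
      measureReal_biUnion_finset hd fun i _ => hB i, Complex.ofReal_sum]
    simp_rw [inner_spectralProj_self hT (hB _)]

theorem hasSum_spectralProj {B : ℕ → Set ℝ} (hB : ∀ n, MeasurableSet (B n))
    (hd : Pairwise fun m n => Disjoint (B m) (B n)) (v : H) :
    HasSum (fun n => spectralProj hT (B n) v) (spectralProj hT (⋃ n, B n) v) := by
  have hrest : ∀ s : Finset ℕ,
      ‖∑ n ∈ s, spectralProj hT (B n) v - spectralProj hT (⋃ n, B n) v‖ ^ 2 =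
        (spectralMeasure hT v).real (⋃ n, B n) - ∑ n ∈ s, (spectralMeasure hT v).real (B n) := by
    intro s
    have hs : MeasurableSet (⋃ n ∈ s, B n) := s.measurableSet_biUnion fun n _ => hB n
    have hsub : ⋃ n ∈ s, B n ⊆ ⋃ n, B n := Set.iUnion₂_subset_iUnion _ _
    have hsplit := spectralProj_union hT hs ((MeasurableSet.iUnion hB).diff hs)
      Set.disjoint_sdiff_right
    rw [Set.union_sdiff_cancel hsub, spectralProj_biUnion hT s hB (hd.set_pairwise _)] at hsplit
    rw [hsplit, add_apply, sum_apply, sub_add_cancel_left, norm_neg,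
      norm_sq_spectralProj hT ((MeasurableSet.iUnion hB).diff hs),
      measureReal_sdiff hsub hs, measureReal_biUnion_finset (hd.set_pairwise _) fun n _ => hB n]
  have hsum : HasSum (fun n => (spectralMeasure hT v).real (B n))
      ((spectralMeasure hT v).real (⋃ n, B n)) := by
    simpa only [Measure.toSignedMeasure_apply_measurable, hB, MeasurableSet.iUnion hB] using
      (spectralMeasure hT v).toSignedMeasure.m_iUnion hB hd
  have hlim := hsum.const_sub ((spectralMeasure hT v).real (⋃ n, B n))
  rw [sub_self] at hlim
  simp_rw [← hrest] at hlim
  rw [HasSum, tendsto_iff_norm_sub_tendsto_zero]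
  simpa using hlim.sqrt

include hT in
theorem exists_isSpectralResolution :
    ∃ E : ProjectionValuedMeasure H, IsSpectralResolution T E := by
  let E : ProjectionValuedMeasure H :=
    { proj := spectralProj hT
      isStarProjection := fun _ => isStarProjection_spectralProj hT
      proj_empty := spectralProj_empty hT
      proj_univ := spectralProj_univ hT
      proj_inter := fun _ _ => spectralProj_inter hT
      hasSum_proj := fun _ => hasSum_spectralProj hT }
  refine ⟨E, fun f hf hc v => ?_⟩
  have hmeasure : E.measure v = spectralMeasure hT v := by
    ext B hB
    rw [E.measure_apply v hB, show E.proj B = spectralProj hT B from rfl,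
      inner_spectralProj_self hT hB, Complex.ofReal_re, ofReal_measureReal]
  rw [hmeasure]
  exact (integral_spectralMeasure hT v ⟨⟨f, hf⟩, hc⟩).symm

end SpectralProjection

section ReducingSubspaces

variable {H : Type*} [NormedAddCommGroup H] [InnerProductSpace ℂ H]

theorem commute_starProjection_iff_inner_reflection {K : Submodule ℂ H}
    [K.HasOrthogonalProjection] {A : H →L[ℂ] H} : Commute K.starProjection A ↔
      ∀ v, ⟪K.reflection v, A (K.reflection v)⟫_ℂ = ⟪v, A v⟫_ℂ := by
  have : IsAddTorsionFree H := .of_isTorsionFree ℂ _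
  have hcomm : Commute K.starProjection A ↔ ∀ v, A (K.reflection v) = K.reflection (A v) := by
    simp only [Commute, SemiconjBy, DFunLike.ext_iff, mul_apply_eq_comp, K.reflection_apply,
      map_sub, map_nsmul, sub_left_inj]
    exact forall_congr' fun v =>
      eq_comm.trans (nsmul_right_injective two_ne_zero).eq_iff.symm
  rw [hcomm]
  refine ⟨fun h v => by rw [h, LinearIsometryEquiv.inner_map_map], fun h v => ?_⟩
  have hconj : A = (K.reflection : H →L[ℂ] H) ∘L A ∘L (K.reflection : H →L[ℂ] H) :=
    ext_inner_self fun v => by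
      rw [← h, ← K.reflection.inner_map_map]
      simp
  simpa using DFunLike.congr_fun hconj (K.reflection v)

variable [CompleteSpace H]

namespace ProjectionValuedMeasure

variable (E : ProjectionValuedMeasure H)

instance (v : H) : IsFiniteMeasure (E.measure v) :=
  ⟨by rw [E.measure_apply v .univ]; exact ENNReal.ofReal_lt_top⟩

theorem inner_proj_self {B : Set ℝ} (hB : MeasurableSet B) (v : H) :
    ⟪v, E.proj B v⟫_ℂ = ((E.measure v).real B : ℂ) := by
  have hpos := (ContinuousLinearMap.IsPositive.of_isStarProjection
    (E.isStarProjection B hB)).inner_nonneg_right v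
  rw [measureReal_def, E.measure_apply v hB, ENNReal.toReal_ofReal (Complex.nonneg_iff.1 hpos).1]
  exact Complex.eq_re_of_ofReal_le hpos

theorem forall_commute_starProjection_proj_iff {K : Submodule ℂ H} [K.HasOrthogonalProjection] :
    (∀ B, MeasurableSet B → Commute K.starProjection (E.proj B)) ↔
      ∀ v, E.measure (K.reflection v) = E.measure v := by
  simp only [commute_starProjection_iff_inner_reflection]
  refine ⟨fun h v => Measure.ext fun B hB => ?_, fun h B hB v => ?_⟩
  · rw [← measureReal_eq_measureReal_iff]
    exact_mod_cast (E.inner_proj_self hB _).symm.trans ((h B hB v).trans (E.inner_proj_self hB _))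
  · rw [E.inner_proj_self hB, E.inner_proj_self hB, h]

theorem proj_compl {B : Set ℝ} (hB : MeasurableSet B) : E.proj Bᶜ = 1 - E.proj B :=
  eq_sub_of_add_eq' <| ext_inner_self fun v => by
    rw [← E.proj_univ, add_apply, inner_add_right, E.inner_proj_self hB,
      E.inner_proj_self hB.compl, E.inner_proj_self .univ, ← Complex.ofReal_add,
      measureReal_add_measureReal_compl hB]

end ProjectionValuedMeasure

variable {T : H →ₗ.[ℂ] H}

theorem IsSpectralResolution.inner_funCalc {E : ProjectionValuedMeasure H}
    (hE : IsSpectralResolution T E) (f : C_c(ℝ, ℂ)) (v : H) :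
    ⟪v, funCalc T f v⟫_ℂ = ∫ x, f x ∂(E.measure v) :=
  hE f f.continuous f.hasCompactSupport v

theorem IsSpectralResolution.reduces_iff (hT : IsSelfAdjoint T) {E : ProjectionValuedMeasure H}
    (hE : IsSpectralResolution T E) {K : Submodule ℂ H} [K.HasOrthogonalProjection] :
    Reduces T K ↔ ∀ B, MeasurableSet B → Commute K.starProjection (E.proj B) := by
  rw [reduces_iff_forall_commute_funCalc hT, E.forall_commute_starProjection_proj_iff]
  simp only [commute_starProjection_iff_inner_reflection]
  refine ⟨fun h v => Measure.ext_of_integral_eq_on_compactlySupported fun f => ?_,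
    fun h f v => ?_⟩
  · have hf := h (complexify f) v
    simp only [hE.inner_funCalc, complexify_apply, integral_complex_ofReal] at hf
    exact_mod_cast hf
  · rw [hE.inner_funCalc, hE.inner_funCalc, h]

end ReducingSubspaces

section Spanning

variable {H : Type*} [NormedAddCommGroup H] [InnerProductSpace ℂ H] [CompleteSpace H]
  {T : H →ₗ.[ℂ] H}

-- The closed span `L` on the right is invariant under each `p i`, hence reducing. It contains `R`
-- because each `p i` annihilates `w - P w` for `w ∈ R` and the projection `P` onto `L`.
theorem orbit_eq_topologicalClosure_iSup_map (hT : IsSelfAdjoint T) {ι : Type*}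
    {p : ι → H →L[ℂ] H} (hself : ∀ i, IsSelfAdjoint (p i))
    (hmul : ∀ i j, p i * p j = 0 ∨ ∃ k, p i * p j = p k) (htotal : ∀ w, (∀ i, p i w = 0) → w = 0)
    (hred : ∀ (K : Submodule ℂ H) [K.HasOrthogonalProjection],
      Reduces T K ↔ ∀ i, Commute K.starProjection (p i)) (R : Submodule ℂ H) :
    orbit T (R : Set H) = (⨆ i, R.map (p i : H →ₗ[ℂ] H)).topologicalClosure := by
  set L := (⨆ i, R.map (p i : H →ₗ[ℂ] H)).topologicalClosure
  have hL : IsClosed (L : Set H) := Submodule.isClosed_topologicalClosure _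
  have : CompleteSpace L := hL.completeSpace_coe
  have hmem : ∀ i, ∀ w ∈ R, p i w ∈ L := fun i w hw =>
    Submodule.le_topologicalClosure _ (Submodule.mem_iSup_of_mem i ⟨w, hw, rfl⟩)
  have hinv : ∀ i, ∀ x ∈ L, p i x ∈ L := fun i => by
    refine Submodule.topologicalClosure_minimal (t := L.comap (p i : H →ₗ[ℂ] H)) _
      (iSup_le fun j => ?_) (hL.preimage (p i).continuous)
    rintro _ ⟨w, hw, rfl⟩
    change (p i * p j) w ∈ L
    obtain h | ⟨k, h⟩ := hmul i j
    · rw [h]; exact L.zero_mem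
    · rw [h]; exact hmem k w hw
  have hcomm : ∀ i, Commute L.starProjection (p i) := fun i =>
    commute_starProjection_iff.2 ⟨hinv i, by rw [(hself i).star_eq]; exact hinv i⟩
  refine le_antisymm (orbit_le_of_reduces hT ((hred L).2 hcomm) fun w hw => ?_) ?_
  · have hw0 : w - L.starProjection w = 0 := htotal _ fun i => by
      have hPw : L.starProjection (p i w) = p i (L.starProjection w) :=
        DFunLike.congr_fun (hcomm i).eq w
      rw [map_sub, ← hPw, Submodule.starProjection_eq_self_iff.2 (hmem i w hw), sub_self]
    exact Submodule.starProjection_eq_self_iff.1 (sub_eq_zero.1 hw0).symm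
  · refine Submodule.topologicalClosure_minimal _ (iSup_le fun i => ?_) (isClosed_orbit T _)
    rintro _ ⟨w, hw, rfl⟩
    exact (commute_starProjection_iff.1 ((hred _).1 (reduces_orbit hT _) i)).1 w
      (subset_orbit hT _ hw)

end Spanning

section ShortIntervals

/-- The intervals contained in some interval of length `ε`. -/
def shortIntervals (ε : ℝ) : Set (Set ℝ) :=
  {Δ | Δ.OrdConnected ∧ ∃ a : ℝ, Δ ⊆ Set.Icc a (a + ε)}

theorem isPiSystem_shortIntervals (ε : ℝ) : IsPiSystem (shortIntervals ε) := by
  rintro A ⟨hA, a, ha⟩ B ⟨hB, -⟩ -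
  exact ⟨hA.inter hB, a, Set.inter_subset_left.trans ha⟩

theorem borel_eq_generateFrom_shortIntervals {ε : ℝ} (hε : 0 < ε) :
    (inferInstance : MeasurableSpace ℝ) = .generateFrom (shortIntervals ε) := by
  refine le_antisymm ?_ (MeasurableSpace.generateFrom_le fun Δ hΔ => hΔ.1.measurableSet)
  have hbasis : TopologicalSpace.IsTopologicalBasis {Δ ∈ shortIntervals ε | IsOpen Δ} := by
    refine TopologicalSpace.isTopologicalBasis_of_isOpen_of_nhds (fun Δ hΔ => hΔ.2)
      fun a U ha hU => ?_
    obtain ⟨δ, hδ, hδU⟩ := Metric.isOpen_iff.1 hU a ha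
    refine ⟨Metric.ball a (min δ (ε / 2)), ⟨⟨?_, a - ε / 2, ?_⟩, Metric.isOpen_ball⟩,
      Metric.mem_ball_self (lt_min hδ (half_pos hε)),
      (Metric.ball_subset_ball (min_le_left _ _)).trans hδU⟩
    · rw [Real.ball_eq_Ioo]
      exact Set.ordConnected_Ioo
    · refine (Metric.ball_subset_ball (min_le_right _ _)).trans ?_
      rw [Real.ball_eq_Ioo]
      exact Set.Ioo_subset_Icc_self.trans (Set.Icc_subset_Icc_right (by linarith))
  rw [BorelSpace.measurable_eq (α := ℝ), hbasis.borel_eq_generateFrom]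
  exact MeasurableSpace.generateFrom_mono fun Δ hΔ => hΔ.1

variable {H : Type*} [NormedAddCommGroup H] [InnerProductSpace ℂ H] [CompleteSpace H]

theorem ProjectionValuedMeasure.proj_mem_of_shortIntervals (E : ProjectionValuedMeasure H) {ε : ℝ}
    (hε : 0 < ε) {L : Submodule ℂ H} (hL : IsClosed (L : Set H)) {w : H}
    (h : ∀ Δ ∈ shortIntervals ε, E.proj Δ w ∈ L) {B : Set ℝ} (hB : MeasurableSet B) :
    E.proj B w ∈ L := by
  have hunion : ∀ A : ℕ → Set ℝ, (∀ n, MeasurableSet (A n)) →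
      Pairwise (fun m n => Disjoint (A m) (A n)) → (∀ n, E.proj (A n) w ∈ L) →
      E.proj (⋃ n, A n) w ∈ L := fun A hA hd hmem =>
    hL.mem_of_tendsto (E.hasSum_proj A hA hd w)
      (.of_forall fun s => L.sum_mem fun n _ => hmem n)
  have hw : w ∈ L := by
    let e : ℕ ≃ ℤ := Equiv.intEquivNat.symm
    have hIco := hunion (fun n => Set.Ico (e n • ε) ((e n + 1) • ε)) (fun n => measurableSet_Ico)
      (fun m n hmn => Set.pairwise_disjoint_Ico_zsmul ε (e.injective.ne hmn))
      (fun n => h _ ⟨Set.ordConnected_Ico, e n • ε, by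
        rw [add_smul, one_smul]; exact Set.Ico_subset_Icc_self⟩)
    rwa [e.surjective.iUnion_comp fun n : ℤ => Set.Ico (n • ε) ((n + 1) • ε),
      iUnion_Ico_zsmul hε, E.proj_univ] at hIco
  induction B, hB using MeasurableSpace.induction_on_inter
    (borel_eq_generateFrom_shortIntervals hε) (isPiSystem_shortIntervals ε) with
  | empty => rw [E.proj_empty]; exact L.zero_mem
  | basic Δ hΔ => exact h Δ hΔ
  | compl A hA hmem => rw [E.proj_compl hA]; exact L.sub_mem hw hmem
  | iUnion A hd hA hmem => exact hunion A hA hd hmem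

variable {T : H →ₗ.[ℂ] H} {E : ProjectionValuedMeasure H}

theorem IsSpectralResolution.orbit_eq_iSup_measurableSet (hE : IsSpectralResolution T E)
    (hT : IsSelfAdjoint T) (R : Submodule ℂ H) : orbit T (R : Set H) =
      (⨆ B : {B : Set ℝ // MeasurableSet B}, R.map (E.proj B : H →ₗ[ℂ] H)).topologicalClosure := by
  refine orbit_eq_topologicalClosure_iSup_map hT
    (p := fun B : {B : Set ℝ // MeasurableSet B} => E.proj B) (fun B => ?_)
    (fun A B => .inr ⟨⟨A ∩ B, A.2.inter B.2⟩, (E.proj_inter A B A.2 B.2).symm⟩) (fun w hw => ?_)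
    (fun K _ => ?_) R
  · exact (E.isStarProjection B B.2).isSelfAdjoint
  · have huniv : E.proj Set.univ w = 0 := hw ⟨Set.univ, .univ⟩
    rwa [E.proj_univ, one_apply_eq_self] at huniv
  · rw [hE.reduces_iff hT, Subtype.forall]

theorem IsSpectralResolution.orbit_eq (hE : IsSpectralResolution T E) (hT : IsSelfAdjoint T)
    (R : Submodule ℂ H) {p : Set ℝ → Prop} (hp : ∀ Δ, p Δ → MeasurableSet Δ) {ε : ℝ} (hε : 0 < ε)
    (hshort : ∀ Δ ∈ shortIntervals ε, p Δ) :
    orbit T (R : Set H) =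
      (⨆ (Δ : Set ℝ) (_ : p Δ), R.map (E.proj Δ : H →ₗ[ℂ] H)).topologicalClosure := by
  rw [hE.orbit_eq_iSup_measurableSet hT]
  refine le_antisymm (Submodule.topologicalClosure_minimal _ (iSup_le fun B => ?_)
    (Submodule.isClosed_topologicalClosure _)) (Submodule.topologicalClosure_mono ?_)
  · rintro _ ⟨w, hw, rfl⟩
    exact E.proj_mem_of_shortIntervals hε (Submodule.isClosed_topologicalClosure _)
      (fun Δ hΔ => Submodule.le_topologicalClosure _
        (Submodule.mem_iSup_of_mem Δ (Submodule.mem_iSup_of_mem (hshort Δ hΔ)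
          (Submodule.mem_map_of_mem hw)))) B.2
  · exact iSup₂_le fun Δ hΔ => le_iSup_of_le ⟨Δ, hp Δ hΔ⟩ le_rfl

end ShortIntervals

section PurePointSpectrum

variable {H : Type*} [NormedAddCommGroup H] [InnerProductSpace ℂ H] {T : H →ₗ.[ℂ] H}

theorem mem_eigenspace_iff_mem_graph {z : ℂ} {x : H} :
    x ∈ eigenspace T z ↔ (x, z • x) ∈ T.graph := by
  rw [LinearPMap.mem_graph_iff]
  constructor
  · exact fun ⟨hx, h⟩ => ⟨⟨x, hx⟩, rfl, h⟩
  · rintro ⟨⟨x', hx⟩, rfl, h⟩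
    exact ⟨hx, h⟩

theorem Reduces.starProjection_mem_eigenspace {K : Submodule ℂ H} [K.HasOrthogonalProjection]
    (hK : Reduces T K) {z : ℂ} {x : H} (hx : x ∈ eigenspace T z) :
    K.starProjection x ∈ eigenspace T z := by
  rw [mem_eigenspace_iff_mem_graph] at hx ⊢
  simpa using hK _ _ hx

theorem HasPurePointSpectrum.ext_of_eqOn_eigenspace (h : HasPurePointSpectrum T) {A B : H →L[ℂ] H}
    (hAB : ∀ z, ∀ x ∈ eigenspace T z, A x = B x) : A = B := by
  have hle : ⨆ z, eigenspace T z ≤ LinearMap.eqLocus (A : H →ₗ[ℂ] H) B := iSup_le hAB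
  have htop := Submodule.topologicalClosure_minimal _ hle (isClosed_eq A.continuous B.continuous)
  rw [h] at htop
  exact ContinuousLinearMap.ext fun x => htop (Submodule.mem_top (x := x))

variable [CompleteSpace H]

theorem isOrtho_eigenspace (hT : IsSelfAdjoint T) {z w : ℂ} (hzw : z ≠ w) :
    eigenspace T z ⟂ eigenspace T w := by
  rw [Submodule.isOrtho_iff_inner_eq]
  intro x hx y hy
  by_cases hx0 : x = 0
  · rw [hx0, inner_zero_left]
  rw [mem_eigenspace_iff_mem_graph] at hx hy
  have hreal := inner_eq_of_mem_graph hT hx hx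
  rw [inner_smul_left, inner_smul_right] at hreal
  have hxy := inner_eq_of_mem_graph hT hx hy
  rw [inner_smul_left, inner_smul_right,
    mul_right_cancel₀ (inner_self_ne_zero.2 hx0) hreal] at hxy
  exact (mul_eq_mul_right_iff.1 hxy).resolve_left hzw

theorem reduces_of_le_eigenspace (hT : IsSelfAdjoint T) {z : ℂ} {K : Submodule ℂ H}
    [K.HasOrthogonalProjection] (hK : K ≤ eigenspace T z) : Reduces T K := by
  have hmem : ∀ w : ℂ, w.im ≠ 0 → ∀ x ∈ K, resolventOp T w x ∈ K := fun w hw x hx => by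
    rw [(isResolventAt_resolventOp hT hw).apply_of_mem_eigenspace (hK hx)]
    exact K.smul_mem _ hx
  rw [reduces_iff_commute_resolventOp hT (z := Complex.I) (by simp), commute_starProjection_iff,
    star_resolventOp_I hT]
  exact ⟨hmem _ (by simp), hmem _ (by simp)⟩

theorem topologicalClosure_eigenspace (hT : IsSelfAdjoint T) (z : ℂ) :
    (eigenspace T z).topologicalClosure = eigenspace T z :=
  (isClosed_eigenspace hT z).submodule_topologicalClosure_eq

theorem range_eigenProj (hT : IsSelfAdjoint T) (z : ℂ) :
    (eigenProj T z).range = eigenspace T z :=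
  (Submodule.range_starProjection _).trans (topologicalClosure_eigenspace hT z)

theorem eigenProj_apply_mem (hT : IsSelfAdjoint T) (z : ℂ) (x : H) :
    eigenProj T z x ∈ eigenspace T z :=
  range_eigenProj hT z ▸ ⟨x, rfl⟩

theorem eigenProj_mul_eigenProj (hT : IsSelfAdjoint T) {z w : ℂ} (hzw : z ≠ w) :
    eigenProj T z * eigenProj T w = 0 := by
  refine Submodule.IsOrtho.starProjection_comp_starProjection ?_
  rw [topologicalClosure_eigenspace hT, topologicalClosure_eigenspace hT]
  exact isOrtho_eigenspace hT hzw

theorem isOrtho_map_eigenProj (hT : IsSelfAdjoint T) (R : Submodule ℂ H) {z w : ℂ} (hzw : z ≠ w) :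
    R.map (eigenProj T z : H →ₗ[ℂ] H) ⟂ R.map (eigenProj T w : H →ₗ[ℂ] H) :=
  (isOrtho_eigenspace hT hzw).mono (range_eigenProj hT z ▸ LinearMap.map_le_range)
    (range_eigenProj hT w ▸ LinearMap.map_le_range)

namespace HasPurePointSpectrum

variable (h : HasPurePointSpectrum T)
include h

theorem eq_zero {x : H} (hx : ∀ z, eigenProj T z x = 0) : x = 0 := by
  have hle : ⨆ z, eigenspace T z ≤ (Submodule.span ℂ {x})ᗮ := iSup_le fun z e he => by
    rw [Submodule.mem_orthogonal_singleton_iff_inner_left,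
      ← Submodule.starProjection_eq_self_iff.2 (Submodule.le_topologicalClosure _ he),
      Submodule.inner_starProjection_left_eq_right]
    exact (congrArg (inner ℂ e) (hx z)).trans (inner_zero_right e)
  have htop := Submodule.topologicalClosure_minimal _ hle (Submodule.isClosed_orthogonal _)
  rw [h, top_le_iff, Submodule.orthogonal_eq_top_iff, Submodule.span_singleton_eq_bot] at htop
  exact htop

theorem reduces_iff (hT : IsSelfAdjoint T) {K : Submodule ℂ H} [K.HasOrthogonalProjection] :
    Reduces T K ↔ ∀ z, Commute K.starProjection (eigenProj T z) := by
  refine ⟨fun hK z => ?_, fun hK => ?_⟩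
  · refine Commute.symm (commute_starProjection_iff.2 ?_)
    rw [(isSelfAdjoint_starProjection K).star_eq, topologicalClosure_eigenspace hT, and_self]
    exact fun x hx => hK.starProjection_mem_eigenspace hx
  · rw [reduces_iff_commute_resolventOp hT (z := Complex.I) (by simp)]
    have hR := isResolventAt_resolventOp hT (z := Complex.I) (by simp)
    refine h.ext_of_eqOn_eigenspace fun z x hx => ?_
    have hPx : K.starProjection x ∈ eigenspace T z := by
      have hz := (commute_starProjection_iff.1 (hK z).symm).1 x
      rw [topologicalClosure_eigenspace hT] at hz
      exact hz hx
    rw [mul_apply_eq_comp, mul_apply_eq_comp, hR.apply_of_mem_eigenspace hx,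
      hR.apply_of_mem_eigenspace hPx, map_smul]

theorem orbit_eq (hT : IsSelfAdjoint T) (R : Submodule ℂ H) : orbit T (R : Set H) =
    (⨆ z : ℂ, R.map (eigenProj T z : H →ₗ[ℂ] H)).topologicalClosure := by
  refine orbit_eq_topologicalClosure_iSup_map hT (fun z => isSelfAdjoint_starProjection _)
    (fun z w => ?_) (fun w => h.eq_zero) (fun K _ => h.reduces_iff hT) R
  obtain rfl | hzw := eq_or_ne z w
  · exact .inr ⟨z, (Submodule.isIdempotentElem_starProjection _).eq⟩
  · exact .inl (eigenProj_mul_eigenProj hT hzw)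

theorem exists_isEigenmode_mem (hT : IsSelfAdjoint T) {K : Submodule ℂ H}
    [K.HasOrthogonalProjection] (hK : Reduces T K) (hne : K ≠ ⊥) : ∃ φ ∈ K, IsEigenmode T φ := by
  obtain ⟨x, hx, hx0⟩ := K.exists_mem_ne_zero_of_ne_bot hne
  obtain ⟨z, hz⟩ := not_forall.1 fun hzero => hx0 (h.eq_zero hzero)
  exact ⟨eigenProj T z x, (commute_starProjection_iff.1 ((h.reduces_iff hT).1 hK z)).1 x hx, hz, z,
    eigenProj_apply_mem hT z x⟩

end HasPurePointSpectrum

theorem mem_orthogonal_orbit_iff (hT : IsSelfAdjoint T) (R : Submodule ℂ H) {φ : H}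
    (hφ : IsEigenmode T φ) : φ ∈ (orbit T (R : Set H))ᗮ ↔ φ ∈ Rᗮ := by
  obtain ⟨-, z, hφ⟩ := hφ
  have hred : Reduces T (Submodule.span ℂ {φ})ᗮ :=
    (reduces_of_le_eigenspace hT ((Submodule.span_singleton_le_iff_mem _ _).2 hφ)).orthogonal
  have hortho : ∀ K : Submodule ℂ H, φ ∈ Kᗮ ↔ K ≤ (Submodule.span ℂ {φ})ᗮ := fun K => by
    rw [← Submodule.span_singleton_le_iff_mem]
    exact Submodule.isOrtho_comm
  rw [hortho, hortho]
  exact ⟨(subset_orbit hT _).trans, orbit_le_of_reduces hT hred⟩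

theorem HasPurePointSpectrum.orbit_range_adjoint_eq_top_iff (h : HasPurePointSpectrum T)
    (hT : IsSelfAdjoint T) {G : Type*} [NormedAddCommGroup G] [InnerProductSpace ℂ G]
    [CompleteSpace G] (Γ : H →L[ℂ] G) :
    orbit T ((ContinuousLinearMap.adjoint Γ).range : Set H) = ⊤ ↔
      ∀ φ : H, IsEigenmode T φ → Γ φ ≠ 0 := by
  have hker : ∀ φ, IsEigenmode T φ →
      (φ ∈ (orbit T ((ContinuousLinearMap.adjoint Γ).range : Set H))ᗮ ↔ Γ φ = 0) :=
    fun φ hφ => by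
      rw [mem_orthogonal_orbit_iff hT _ hφ, ContinuousLinearMap.orthogonal_range,
        ContinuousLinearMap.adjoint_adjoint]
      rfl
  rw [← Submodule.orthogonal_eq_bot_iff]
  refine ⟨fun hbot φ hφ hΓ => hφ.1 ?_, fun hΓ => by_contra fun hne => ?_⟩
  · exact (Submodule.mem_bot ℂ).1 (hbot ▸ (hker φ hφ).2 hΓ)
  · obtain ⟨φ, hφK, hφ⟩ := h.exists_isEigenmode_mem hT (reduces_orbit hT _).orthogonal hne
    exact hΓ φ hφ ((hker φ hφ).1 hφK)

end PurePointSpectrum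

end OpenSystem

theorem mainTheorem6 {H : Type*} [NormedAddCommGroup H] [InnerProductSpace ℂ H] [CompleteSpace H]
    (Ω : H →ₗ.[ℂ] H) (hΩ : IsSelfAdjoint Ω)
    (H₁ : Submodule ℂ H) [CompleteSpace H₁]
    (Γ : H₁ᗮ →L[ℂ] H₁) (hΓ : OpenSystem.HasBoundedCoupling Ω H₁ Γ)
    (Ω₂ : H₁ᗮ →ₗ.[ℂ] H₁ᗮ) (hΩ₂ : Ω₂ = OpenSystem.compression Ω H₁ᗮ)
    (R : Submodule ℂ H₁ᗮ) (hR : R = (ContinuousLinearMap.adjoint Γ).range) :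
    -- pure point spectrum: projections onto the eigenspaces
    (OpenSystem.HasPurePointSpectrum Ω₂ →
      OpenSystem.coupledComponent Ω H₁ = OpenSystem.orbit Ω₂ (R : Set H₁ᗮ) ∧
      OpenSystem.orbit Ω₂ (R : Set H₁ᗮ) =
        (⨆ z : ℂ, R.map (OpenSystem.eigenProj Ω₂ z : H₁ᗮ →ₗ[ℂ] H₁ᗮ)).topologicalClosure ∧
      Pairwise (fun z w : ℂ => R.map (OpenSystem.eigenProj Ω₂ z : H₁ᗮ →ₗ[ℂ] H₁ᗮ) ⟂
        R.map (OpenSystem.eigenProj Ω₂ w : H₁ᗮ →ₗ[ℂ] H₁ᗮ))) ∧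
    -- general spectrum: spectral projections of intervals
    ((∃ E : OpenSystem.ProjectionValuedMeasure H₁ᗮ, OpenSystem.IsSpectralResolution Ω₂ E) ∧
      ∀ E : OpenSystem.ProjectionValuedMeasure H₁ᗮ, OpenSystem.IsSpectralResolution Ω₂ E →
        OpenSystem.coupledComponent Ω H₁ =
          (⨆ (Δ : Set ℝ) (_ : Δ.OrdConnected),
            R.map (E.proj Δ : H₁ᗮ →ₗ[ℂ] H₁ᗮ)).topologicalClosure ∧
        ∀ ε : ℝ, 0 < ε →
          OpenSystem.coupledComponent Ω H₁ =
            (⨆ (Δ : Set ℝ) (_ : Δ.OrdConnected ∧ ∃ a : ℝ, Δ ⊆ Set.Icc a (a + ε)),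
              R.map (E.proj Δ : H₁ᗮ →ₗ[ℂ] H₁ᗮ)).topologicalClosure) ∧
    -- pure point spectrum: criterion for all hidden variables to be coupled
    (OpenSystem.HasPurePointSpectrum Ω₂ →
      (OpenSystem.coupledComponent Ω H₁ = ⊤ ↔
        ∀ φ : H₁ᗮ, OpenSystem.IsEigenmode Ω₂ φ → Γ φ ≠ 0)) := by
  subst hΩ₂ hR
  have hΩ₂ := hΓ.isSelfAdjoint_compression hΩ
  rw [hΓ.coupledComponent_eq hΩ]
  refine ⟨fun hpure => ⟨rfl, hpure.orbit_eq hΩ₂ _, fun z w hzw =>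
      OpenSystem.isOrtho_map_eigenProj hΩ₂ _ hzw⟩,
    ⟨OpenSystem.exists_isSpectralResolution hΩ₂, fun E hE => ⟨?_, fun ε hε => ?_⟩⟩,
    fun hpure => hpure.orbit_range_adjoint_eq_top_iff hΩ₂ Γ⟩
  · exact hE.orbit_eq hΩ₂ _ (fun Δ hΔ => hΔ.measurableSet) one_pos fun Δ hΔ => hΔ.1
  · exact hE.orbit_eq hΩ₂ _ (fun Δ hΔ => hΔ.1.measurableSet) hε fun Δ hΔ => hΔ
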